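/- Let $\Sigma$ be a finite alphabet and $\ast\notin\Sigma$ a wildcard symbol. For $w\in\Sigma^{+}$ let $\mathrm{Sub}(w)$ be the set of non-empty substrings of $w$, and let $\mathcal{T}(w)$ be the set of block-compressed templates for $w$, i.e. of all strings obtained from a substring $u$ of $w$ by cutting $u$ into consecutive non-empty blocks and replacing some, but not all and not none, of the blocks by a single $\ast$ each. Put $O_\ast(w)=\mathrm{Sub}(w)\cup\mathcal{T}(w)$. The rules are the concatenations $x\circ y\to xy$, where $x,y\in O_\ast(w)\cup\{\ast\}$ and $xy\in O_\ast(w)$, and the instantiations $T\bullet_S u\to T[S\mapsto u]$, where $T\in\mathcal{T}(w)$, $S$ is a non-empty set of wildcard positions of $T$, $u\in O_\ast(w)$, and the string $T[S\mapsto u]$ obtained from $T$ by replacing each wildcard at a position in $S$ by $u$ lies in $O_\ast(w)$. A templated assembly plan for $w$ is a finite sequence of elements of $O_\ast(w)\cup\{\ast\}$ which contains $w$ and in which each element is a monomer (a single letter or $\ast$) or is obtained by a rule from earlier elements; its cost is the number of indices whose element is obtained by a rule from earlier elements. The decision problem TAI-DEC asks, given $w\in\Sigma^{+}$ and $k\in\mathbb{N}$,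 whether there is a templated assembly plan for $w$ of cost at most $k$. (1) TAI-DEC is in $\mathrm{NP}$, both when $k$ is given in unary and when $k$ is given in binary. (2) In both cases, sequences of rule applications are certificates. Precisely, consider the following relation between instances $(w,k)$ and certificates: the certificate is a list of at most $k$ rule applications, written out with their operands, the chosen sets of wildcard positions and the objects they produce, such that every operand is a monomer or the product of an earlier rule application, and $w$ is a monomer or one of the products. This relation is decidable in polynomial time in the length of the instance and the certificate, and $(w,k)$ is a yes-instance of TAI-DEC if and only if it has such a certificate of length polynomial in the length of the instance (which is $|w|+k$ for $k$ in unary). (3) Given $w\in\Sigma^{*}$ and a string $x$ over $\Sigma\cup\{\ast\}$, it is decidable in time polynomial in $|w|+|x|$ whether $x\in\mathrm{Sub}(w)\cup\mathcal{T}(w)$ (for empty $w$ this set is empty). -/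

import Mathlib

namespace TAssembly

open Computability

/-! ### Polynomial time and NP -/

/-- A predicate on `α` is decidable in polynomial time, with respect to the encoding `enc` of its
arguments as strings, if its characteristic function is computed in polynomial time (in the length
of the encoded argument) by a multi-stack Turing machine all of whose alphabets are finite. -/
def PolyTimeDecidable {α Γ : Type} (enc : α → List Γ) (P : α → Prop) : Prop :=
  ∃ f : α → Bool, (∀ a, f a = true ↔ P a) ∧
    ∃ M : Turing.TM2ComputableInPolyTime enc encodeBool f, ∀ k, Finite (M.tm.Γ k)

/-- The encoding of a pair of strings: the first string followed by the second one, written in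
disjoint copies of the two alphabets. -/
def pairEnc (Γ Δ : Type) : List Γ × List Δ → List (Γ ⊕ Δ) :=
  (encodingProd (encodingList Γ) (encodingList Δ)).encode

/-- `V` is an NP-verifier for the language `L`: it is a relation between input strings and
certificate strings, decidable in polynomial time, such that the members of `L` are exactly the
strings that have a certificate of length polynomial in their own length. -/
def IsNPVerifier {Γ Δ : Type} (L : Set (List Γ)) (V : List Γ → List Δ → Prop) : Prop :=
  PolyTimeDecidable (pairEnc Γ Δ) (fun z => V z.1 z.2) ∧
    ∃ p : Polynomial ℕ, ∀ s : List Γ, s ∈ L ↔ ∃ c : List Δ, c.length ≤ p.eval s.length ∧ V s c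

/-- The class NP of languages over a finite alphabet. -/
def InNP {Γ : Type} (L : Set (List Γ)) : Prop :=
  ∃ (Δ : Type) (_ : Finite Δ) (V : List Γ → List Δ → Prop), IsNPVerifier L V

/-! ### Templated assembly spaces

Strings over `Σ` are lists over `A`; strings over `Σ ∪ {∗}` are lists over `Option A`, where `none`
is the wildcard `∗`. -/

section

variable {A : Type}

/-- The non-empty substrings of `w`, as strings over the alphabet with wildcard. -/
def Sub (w : List A) : Set (List (Option A)) :=
  {x | ∃ u : List A, u ≠ [] ∧ u <:+: w ∧ x = u.map some}

/-- The block-compressed templates for `w`. The list `B` holds the consecutive blocks of a substring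
of `w`, each with its bit: `true` if the block is replaced by the wildcard. -/
def Templates (w : List A) : Set (List (Option A)) :=
  {T | ∃ B : List (List A × Bool),
    (∀ b ∈ B, b.1 ≠ []) ∧
    (B.map Prod.fst).flatten <:+: w ∧
    (∃ b ∈ B, b.2 = true) ∧ (∃ b ∈ B, b.2 = false) ∧
    T = (B.map fun b => if b.2 then [none] else b.1.map some).flatten}

/-- The objects `Sub(w) ∪ 𝒯(w)` of the templated assembly space of `w`. -/
def Objects (w : List A) : Set (List (Option A)) :=
  Sub w ∪ Templates w

/-- A monomer: a single letter or the wildcard. -/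
def IsMonomer (x : List (Option A)) : Prop :=
  ∃ a : Option A, x = [a]

/-- The wildcard positions of `T`. -/
def wildcards (T : List (Option A)) : Set (Fin T.length) :=
  {p | T.get p = none}

/-- `T[S ↦ u]`: the positions in `S` are replaced by `u`. -/
def instantiate (T : List (Option A)) (S : Finset (Fin T.length)) (u : List (Option A)) :
    List (Option A) :=
  (List.finRange T.length).flatMap fun p => if p ∈ S then u else [T.get p]

variable (A) in
/-- Rule applications `x ∘ y → xy` and `T •_S u → T[S ↦ u]`. -/
inductive RuleApp : Type
  | concat (x y : List (Option A))
  | inst (T : List (Option A)) (S : Finset (Fin T.length)) (u : List (Option A))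

/-- The two objects that a rule is applied to. -/
def RuleApp.operands : RuleApp A → List (List (Option A))
  | .concat x y => [x, y]
  | .inst T _ u => [T, u]

/-- The object that is produced. -/
def RuleApp.result : RuleApp A → List (Option A)
  | .concat x y => x ++ y
  | .inst T S u => instantiate T S u

/-- The rule belongs to the templated assembly space of `w`. The bare wildcard, which is a monomer
but not a template, is admitted as an operand of a concatenation. -/
def RuleApp.Allowed (w : List A) : RuleApp A → Prop
  | .concat x y =>
      (x ∈ Objects w ∨ x = [none]) ∧ (y ∈ Objects w ∨ y = [none]) ∧ x ++ y ∈ Objects w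
  | .inst T S u =>
      T ∈ Templates w ∧ S.Nonempty ∧ (S : Set (Fin T.length)) ⊆ wildcards T ∧
        u ∈ Objects w ∧ instantiate T S u ∈ Objects w

/-- The `i`-th member of the sequence `xs` is obtained by applying a rule to earlier members. -/
def ByRule (w : List A) (xs : List (List (Option A))) (i : Fin xs.length) : Prop :=
  ∃ r : RuleApp A, r.Allowed w ∧ r.result = xs.get i ∧ ∀ o ∈ r.operands, ∃ j < i, xs.get j = o

/-- Templated assembly plans for `w`. -/
def IsPlan (w : List A) (xs : List (List (Option A))) : Prop :=
  (∀ x ∈ xs, x ∈ Objects w ∨ x = [none]) ∧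
    (∀ i, IsMonomer (xs.get i) ∨ ByRule w xs i) ∧
    w.map some ∈ xs

/-- The cost of a plan: the number of its composite steps. -/
noncomputable def planCost (w : List A) (xs : List (List (Option A))) : ℕ :=
  {i | ByRule w xs i}.ncard

/-! ### The decision problem -/

/-- The string that encodes the instance `(w, k)`, with `k` encoded by `eN`. -/
def instEnc (eN : Encoding ℕ Bool) : List A × ℕ → List (A ⊕ Bool) :=
  (encodingProd (encodingList A) eN).encode

variable (A) in
/-- The decision problem, as the language of the encodings of its yes-instances. -/
def TAIDec (eN : Encoding ℕ Bool) : Set (List (A ⊕ Bool)) :=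
  {s | ∃ (w : List A) (k : ℕ), w ≠ [] ∧ s = instEnc eN (w, k) ∧
    ∃ xs, IsPlan w xs ∧ planCost w xs ≤ k}

/-! ### Certificates: sequences of rule applications, with the objects they produce -/

/-- The sequence `rs` of rule applications assembles `w` from monomers: every rule is allowed, its
operands are monomers or products of earlier rule applications, and `w` is obtained. -/
def Assembles (rs : List (RuleApp A)) (w : List A) : Prop :=
  (∀ i : Fin rs.length, (rs.get i).Allowed w ∧
    ∀ o ∈ (rs.get i).operands, IsMonomer o ∨ ∃ j < i, (rs.get j).result = o) ∧
  (IsMonomer (w.map some) ∨ ∃ r ∈ rs, r.result = w.map some)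

variable (A) in
/-- The alphabet of certificates: symbols of `Σ ∪ {∗}`, each with a bit which marks the positions
chosen for an instantiation, the tags of the two kinds of rules, and a separator. -/
inductive CertSym : Type
  | sym (a : Option A) (chosen : Bool)
  | concatTag
  | instTag
  | comma

/-- A string without chosen positions. -/
def encodeObj (x : List (Option A)) : List (CertSym A) :=
  x.map fun a => .sym a false

/-- A rule application is written as its tag, its two operands (for an instantiation with the chosen
positions of the template marked) and its product. -/
def RuleApp.encode : RuleApp A → List (CertSym A)
  | .concat x y =>
      .concatTag :: encodeObj x ++ .comma :: encodeObj y ++ .comma :: encodeObj (x ++ y)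
  | .inst T S u =>
      .instTag :: ((List.finRange T.length).map fun p => .sym (T.get p) (decide (p ∈ S))) ++
        .comma :: encodeObj u ++ .comma :: encodeObj (instantiate T S u)

/-- The certificate `c` is a sequence of at most `k` rule applications, with the objects they
produce, which assembles `w`, where `s` encodes `(w, k)`. -/
def PlanVerifier (eN : Encoding ℕ Bool) (s : List (A ⊕ Bool)) (c : List (CertSym A)) : Prop :=
  ∃ (w : List A) (k : ℕ) (rs : List (RuleApp A)), w ≠ [] ∧ s = instEnc eN (w, k) ∧
    c = rs.flatMap RuleApp.encode ∧ Assembles rs w ∧ rs.length ≤ k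

end

end TAssembly

/-! Membership in NP needs short certificates and a fast verifier. Products of allowed rules are
objects, and an object is no longer than `w`, because a template never outgrows the substring that
it compresses. Operands are objects or the bare wildcard, so one rule application is written with at
most `3 * |w| + 3` symbols. The bound `k` does not limit the number of applications usefully when it
is given in binary. However, `w` can always be assembled letter by letter with `|w| - 1`
concatenations, so a plan with more than `|w|` composite steps can be replaced by this one. Hence
`|w|` applications suffice under either encoding (`exists_assembles_of_isPlan`, `mem_taiDec_iff`).

Plans and certificates have the same costs. The composite steps of a plan form a valid list of rule
applications. Conversely, a valid list becomes a plan once the monomers it uses are put in front;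
these are not counted, since a product of an allowed rule has length at least two.

The core of the verifier is the test for objects. A string is an object if and only if it contains a
letter and, after replacing each wildcard by some non-empty string, becomes a substring of `w`
(`mem_objects_iff`). This is decided by dynamic programming: for each initial part of the template,
mark the prefixes of `w` that have a suffix matched by this part. A letter moves the marks one place
to the right, if the next letter of `w` agrees; a wildcard marks every prefix that strictly extends
a marked one (`foldl_sweep`). The verifier cuts a certificate at its tags, checks each piece against
its own re-encoding, tests the rules while it collects the products, and decrements `k` once per
rule. The decrement is abstracted in `Counter`, so that unary and binary bounds are treated alike.

Polynomial time refers to genuine stack machines. Structured stack programs are compiled to them,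
step for step (`Prog.reachesIn_code`). On top of this, `Comp` is a class of polynomial-time
functions closed under composition, pairing, case distinction and loops whose states stay
polynomially bounded (`Comp.foldl`). The tests are then functional programs in this class. -/

namespace TAssembly

open Function StateTransition

/-! ### Structured programs over stacks -/

/-- Structured programs over stacks that are numbered by `ℕ` and have the alphabet `G`.
`pop k p f` pops the stack `k` and goes on with `p` if it was empty, with `f g` if `g` was popped;
`loop k f` pops the stack `k` and executes `f` on the popped symbol until the stack is empty. -/
inductive Prog (G : Type) : Type
  | skip
  | push (k : ℕ) (g : G)
  | seq (p q : Prog G)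
  | pop (k : ℕ) (p : Prog G) (f : G → Prog G)
  | loop (k : ℕ) (f : G → Prog G)

/-- The contents of the stacks. -/
abbrev Env (G : Type) : Type := ℕ → List G

variable {G : Type}

/-- `Run p S S' t`: the program `p` turns the stack contents `S` into `S'` in `t` steps. -/
inductive Run : Prog G → Env G → Env G → ℕ → Prop
  | skip (S) : Run .skip S S 1
  | push (k g S) : Run (.push k g) S (update S k (g :: S k)) 1
  | seq {p q S S' S'' t t'} : Run p S S' t → Run q S' S'' t' → Run (.seq p q) S S'' (t + t')
  | pop_nil {k p f S S' t} : S k = [] → Run p S S' t → Run (.pop k p f) S S' (1 + t)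
  | pop_cons {k p f S S' t g l} : S k = g :: l → Run (f g) (update S k l) S' t →
      Run (.pop k p f) S S' (1 + t)
  | loop_nil {k f S} : S k = [] → Run (.loop k f) S S 1
  | loop_cons {k f S S' S'' t t' g l} : S k = g :: l → Run (f g) (update S k l) S' t →
      Run (.loop k f) S' S'' t' → Run (.loop k f) S S'' (1 + (t + t'))

namespace Prog

/-- All stacks that the program mentions have numbers at most `N`. -/
def Uses (N : ℕ) : Prog G → Prop
  | .skip => True
  | .push k _ => k ≤ N
  | .seq p q => p.Uses N ∧ q.Uses N
  | .pop k p f => k ≤ N ∧ p.Uses N ∧ ∀ g, (f g).Uses N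
  | .loop k f => k ≤ N ∧ ∀ g, (f g).Uses N

theorem Uses.mono {N M : ℕ} (h : N ≤ M) : ∀ {p : Prog G}, p.Uses N → p.Uses M
  | .skip, _ => trivial
  | .push _ _, hp => le_trans (show _ ≤ N from hp) h
  | .seq _ _, hp => ⟨hp.1.mono h, hp.2.mono h⟩
  | .pop _ _ _, hp => ⟨hp.1.trans h, hp.2.1.mono h, fun g => (hp.2.2 g).mono h⟩
  | .loop _ _, hp => ⟨hp.1.trans h, fun g => (hp.2 g).mono h⟩

/-- A program branches over the whole alphabet, so a common bound on its stack numbers exists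
because the alphabet is finite. -/
theorem exists_uses_forall [Finite G] {f : G → Prog G} (h : ∀ g, ∃ N, (f g).Uses N) :
    ∃ N, ∀ g, (f g).Uses N := by
  choose n hn using h
  obtain ⟨N, hN⟩ := (Set.finite_range n).bddAbove
  exact ⟨N, fun g => (hn g).mono (hN ⟨g, rfl⟩)⟩

theorem exists_uses [Finite G] (p : Prog G) : ∃ N, p.Uses N := by
  induction p with
  | skip => exact ⟨0, trivial⟩
  | push k g => exact ⟨k, le_refl k⟩
  | seq p q hp hq =>
    obtain ⟨N, hN⟩ := hp
    obtain ⟨M, hM⟩ := hq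
    exact ⟨max N M, hN.mono (le_max_left _ _), hM.mono (le_max_right _ _)⟩
  | pop k p f hp hf =>
    obtain ⟨N, hN⟩ := hp
    obtain ⟨M, hM⟩ := exists_uses_forall hf
    exact ⟨max k (max N M), le_max_left _ _, hN.mono (by simp), fun g => (hM g).mono (by simp)⟩
  | loop k f hf =>
    obtain ⟨M, hM⟩ := exists_uses_forall hf
    exact ⟨max k M, le_max_left _ _, fun g => (hM g).mono (by simp)⟩

/-- The labels of the translation of a program to a stack machine. -/
def Label : Prog G → Type
  | .skip => Unit
  | .push _ _ => Unit
  | .seq p q => p.Label ⊕ q.Label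
  | .pop _ p f => Option (p.Label ⊕ Σ g, (f g).Label)
  | .loop _ f => Option (Σ g, (f g).Label)

theorem finite_label [Finite G] (p : Prog G) : Finite p.Label := by
  induction p with
  | skip => exact inferInstanceAs (Finite Unit)
  | push k g => exact inferInstanceAs (Finite Unit)
  | seq p q hp hq => exact inferInstanceAs (Finite (p.Label ⊕ q.Label))
  | pop k p f hp hf => exact inferInstanceAs (Finite (Option (p.Label ⊕ Σ g, (f g).Label)))
  | loop k f hf => exact inferInstanceAs (Finite (Option (Σ g, (f g).Label)))

/-- The label at which the translation of a program starts. -/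
def entry : (p : Prog G) → p.Label
  | .skip => ()
  | .push _ _ => ()
  | .seq p _ => .inl p.entry
  | .pop _ _ _ => none
  | .loop _ _ => none

end Prog

/-- The stacks of the machine that executes a program: one for the input, one for the output, and
`N + 1` stacks of the program. -/
inductive Stk (N : ℕ)
  | inp
  | out
  | reg (i : Fin (N + 1))

instance (N : ℕ) : DecidableEq (Stk N)
  | .inp, .inp | .out, .out => isTrue rfl
  | .reg i, .reg j => decidable_of_iff (i = j) (by simp)
  | .inp, .out | .inp, .reg _ | .out, .inp | .out, .reg _ | .reg _, .inp | .reg _, .out =>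
    isFalse (by simp)

noncomputable instance (N : ℕ) : Fintype (Stk N) :=
  Fintype.ofInjective (β := Bool ⊕ Fin (N + 1))
    (fun | .inp => .inl false | .out => .inl true | .reg i => .inr i) <| by
      rintro (_ | _ | i) (_ | _ | j) h <;> simp_all

/-- The alphabets of the stacks. -/
@[reducible] def Stk.Alphabet (X G : Type) {N : ℕ} : Stk N → Type
  | .inp => X
  | .out => Bool
  | .reg _ => G

/-! ### Compilation of structured programs to multi-stack Turing machines -/

section

variable {X Λ : Type} (N : ℕ)

/-- The translation of a program to statements of a stack machine, where `e` embeds the labels of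
the program and `x` is the label to go to in the end. -/
def Prog.code (X : Type) : (p : Prog G) → (p.Label → Λ) → Λ → p.Label →
    Turing.TM2.Stmt (Stk.Alphabet X G (N := N)) Λ (Option G)
  | .skip, _, x, _ => .goto fun _ => x
  | .push k g, _, x, _ => .push (.reg (Fin.ofNat (N + 1) k)) (fun _ => g) (.goto fun _ => x)
  | .seq p q, e, _, .inl l => p.code X (fun l => e (.inl l)) (e (.inr q.entry)) l
  | .seq _ q, e, x, .inr l => q.code X (fun l => e (.inr l)) x l
  | .pop k p f, e, _, none => .pop (.reg (Fin.ofNat (N + 1) k)) (fun _ o => o) (.goto fun v =>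
      match v with
      | none => e (some (.inl p.entry))
      | some g => e (some (.inr ⟨g, (f g).entry⟩)))
  | .pop _ p _, e, x, some (.inl l) => p.code X (fun l => e (some (.inl l))) x l
  | .pop _ _ f, e, x, some (.inr ⟨g, l⟩) => (f g).code X (fun l => e (some (.inr ⟨g, l⟩))) x l
  | .loop k f, e, x, none => .pop (.reg (Fin.ofNat (N + 1) k)) (fun _ o => o) (.goto fun v =>
      match v with
      | none => x
      | some g => e (some ⟨g, (f g).entry⟩))
  | .loop _ f, e, _, some ⟨g, l⟩ => (f g).code X (fun l => e (some ⟨g, l⟩)) (e none) l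

variable {N}

/-- The stacks of the machine, given the contents of the input stack and of the stacks of the
program. -/
def Stk.contents (inp : List X) (S : Env G) : (k : Stk N) → List (Stk.Alphabet X G k)
  | .inp => inp
  | .out => []
  | .reg i => S i

/-- `Fin.ofNat` reduces stack numbers modulo `N + 1`; the reduction is harmless exactly for the
numbers `k ≤ N` that a program may use. -/
theorem Stk.contents_update (inp : List X) (S : Env G) {k : ℕ} (hk : k ≤ N) (l : List G) :
    update (Stk.contents (N := N) inp S) (.reg (Fin.ofNat (N + 1) k)) l =
      Stk.contents inp (update S k l) := by
  funext j
  cases j with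
  | inp => rw [update_of_ne (by simp)]; rfl
  | out => rw [update_of_ne (by simp)]; rfl
  | reg i =>
    have hk' : k % (N + 1) = k := Nat.mod_eq_of_lt (by omega)
    by_cases h : i = Fin.ofNat (N + 1) k
    · subst h
      simp [Stk.contents, hk']
    · have h' : (i : ℕ) ≠ k := by
        rintro rfl
        exact h (by ext; simp)
      rw [update_of_ne (by simpa using h)]
      simp [Stk.contents, h']

theorem Stk.contents_reg (inp : List X) (S : Env G) {k : ℕ} (hk : k ≤ N) :
    Stk.contents (N := N) inp S (.reg (Fin.ofNat (N + 1) k)) = S k := by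
  have hk' : k % (N + 1) = k := Nat.mod_eq_of_lt (by omega)
  simp [Stk.contents, hk']

/-- The configuration `b` is reached from `a` in exactly `n` steps. -/
def ReachesIn {σ : Type*} (f : σ → Option σ) (n : ℕ) (a b : σ) : Prop :=
  (flip bind f)^[n] (some a) = some b

theorem ReachesIn.single {σ : Type*} {f : σ → Option σ} {a b : σ} (h : f a = some b) :
    ReachesIn f 1 a b := h

theorem ReachesIn.trans {σ : Type*} {f : σ → Option σ} {a b c : σ} {n m : ℕ}
    (h : ReachesIn f n a b) (h' : ReachesIn f m b c) : ReachesIn f (n + m) a c := by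
  unfold ReachesIn at *
  rw [Nat.add_comm, iterate_add_apply, h, h']

/-- Induction on the run. The embedding `e` and the exit label `x` vary, so that a subprogram can be
entered with the start of its continuation as its exit; the body of a loop exits to the head of the
loop. The internal state `v` is arbitrary, because it is only read right after a pop has overwritten
it. -/
theorem Prog.reachesIn_code (m : Λ → Turing.TM2.Stmt (Stk.Alphabet X G (N := N)) Λ (Option G))
    (inp : List X) {p : Prog G} {S S' : Env G} {t : ℕ} (h : Run p S S' t) (hp : p.Uses N)
    (e : p.Label → Λ) (x : Λ) (hm : ∀ l, m (e l) = p.code N X e x l) (v : Option G) :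
    ∃ v', ReachesIn (Turing.TM2.step m) t ⟨some (e p.entry), v, Stk.contents inp S⟩
      ⟨some x, v', Stk.contents inp S'⟩ := by
  induction h generalizing v x with
  | skip S =>
    refine ⟨v, .single ?_⟩
    rw [Turing.TM2.step, hm]
    rfl
  | push k g S =>
    refine ⟨v, .single ?_⟩
    rw [Turing.TM2.step, hm]
    simp only [code, Turing.TM2.stepAux]
    rw [Stk.contents_reg _ _ hp, Stk.contents_update _ _ hp]
  | @seq p q S S' S'' t t' _ _ ih ih' =>
    obtain ⟨v₁, h₁⟩ := ih hp.1 (fun l => e (.inl l)) (e (.inr q.entry)) (fun l => hm (.inl l)) v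
    obtain ⟨v₂, h₂⟩ := ih' hp.2 (fun l => e (.inr l)) x (fun l => hm (.inr l)) v₁
    exact ⟨v₂, h₁.trans h₂⟩
  | @pop_nil k p f S S' t hS _ ih =>
    obtain ⟨v₁, h₁⟩ := ih hp.2.1 (fun l => e (some (.inl l))) x (fun l => hm (some (.inl l))) none
    refine ⟨v₁, ReachesIn.trans (.single ?_) h₁⟩
    rw [Turing.TM2.step, hm]
    simp only [code, entry, Turing.TM2.stepAux]
    rw [Stk.contents_reg _ _ hp.1, Stk.contents_update _ _ hp.1, hS, List.tail_nil, ← hS,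
      update_eq_self, hS]
    rfl
  | @pop_cons k p f S S' t g l hS _ ih =>
    obtain ⟨v₁, h₁⟩ := ih (hp.2.2 g) (fun l => e (some (.inr ⟨g, l⟩))) x
      (fun l => hm (some (.inr ⟨g, l⟩))) (some g)
    refine ⟨v₁, ReachesIn.trans (.single ?_) h₁⟩
    rw [Turing.TM2.step, hm]
    simp only [code, entry, Turing.TM2.stepAux]
    rw [Stk.contents_reg _ _ hp.1, Stk.contents_update _ _ hp.1, hS]
    rfl
  | @loop_nil k f S hS =>
    refine ⟨none, .single ?_⟩
    rw [Turing.TM2.step, hm]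
    simp only [code, entry, Turing.TM2.stepAux]
    rw [Stk.contents_reg _ _ hp.1, Stk.contents_update _ _ hp.1, hS, List.tail_nil, ← hS,
      update_eq_self, hS]
    rfl
  | @loop_cons k f S S' S'' t t' g l hS _ _ ih ih' =>
    obtain ⟨v₁, h₁⟩ := ih (hp.2 g) (fun l => e (some ⟨g, l⟩)) (e none)
      (fun l => hm (some ⟨g, l⟩)) (some g)
    obtain ⟨v₂, h₂⟩ := ih' hp e x hm v₁
    refine ⟨v₂, ReachesIn.trans (.single ?_) (h₁.trans h₂)⟩
    rw [Turing.TM2.step, hm]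
    simp only [code, entry, Turing.TM2.stepAux]
    rw [Stk.contents_reg _ _ hp.1, Stk.contents_update _ _ hp.1, hS]
    rfl

/-- The statements of the machine that executes a program: the label `inr false` moves the input,
in reverse, to the stack `0`; the label `inr true` turns the content of the stack `1` into the
output, where the empty stack means `false`. -/
def Prog.machineCode (N : ℕ) (g₀ : G) (emb : X → G) (p : Prog G) :
    p.Label ⊕ Bool → Turing.TM2.Stmt (Stk.Alphabet X G (N := N)) (p.Label ⊕ Bool) (Option G)
  | .inl l => p.code N X .inl (.inr true) l
  | .inr false => .pop .inp (fun _ o => o.map emb)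
      (.branch (fun v => v.isSome)
        (.push (.reg (Fin.ofNat (N + 1) 0)) (fun v => v.getD g₀) (.goto fun _ => .inr false))
        (.goto fun _ => .inl p.entry))
  | .inr true => .pop (.reg (Fin.ofNat (N + 1) 1)) (fun _ o => o)
      (.push .out (fun v => v.isSome) (.load (fun _ => none) .halt))

/-- The machine that executes a program. -/
noncomputable def Prog.machine [Finite X] [Finite G] (N : ℕ) (g₀ : G) (emb : X → G) (p : Prog G) :
    Turing.FinTM2 where
  K := Stk N
  k₀ := .inp
  k₁ := .out
  Γ := Stk.Alphabet X G
  Λ := p.Label ⊕ Bool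
  main := .inr false
  ΛFin := haveI := p.finite_label; Fintype.ofFinite _
  σ := Option G
  initialState := none
  σFin := Fintype.ofFinite _
  Γk₀Fin := Fintype.ofFinite X
  m := p.machineCode N g₀ emb

theorem Stk.update_contents_inp (inp inp' : List X) (S : Env G) :
    update (Stk.contents (N := N) inp S) .inp inp' = Stk.contents inp' S := by
  funext j
  cases j with
  | inp => simp [Stk.contents]
  | out => rw [update_of_ne (by simp)]; rfl
  | reg i => rw [update_of_ne (by simp)]; rfl

theorem Prog.reachesIn_input (g₀ : G) (emb : X → G) (p : Prog G) (l : List X) (S : Env G)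
    (v : Option G) :
    ∃ v', ReachesIn (Turing.TM2.step (p.machineCode N g₀ emb)) (l.length + 1)
      ⟨some (.inr false), v, Stk.contents l S⟩
      ⟨some (.inl p.entry), v',
        Stk.contents [] (update S 0 ((l.map emb).reverse ++ S 0))⟩ := by
  induction l generalizing S v with
  | nil =>
    refine ⟨none, .single ?_⟩
    simp [machineCode, Turing.TM2.step, Turing.TM2.stepAux, Stk.contents,
      Stk.update_contents_inp]
  | cons a l ih =>
    obtain ⟨v', h⟩ := ih (update S 0 (emb a :: S 0)) (some (emb a))
    refine ⟨v', ?_⟩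
    rw [List.length_cons, Nat.add_comm]
    refine ReachesIn.trans (b := ⟨some (.inr false), some (emb a),
      Stk.contents l (update S 0 (emb a :: S 0))⟩) (.single ?_) ?_
    · rw [Turing.TM2.step]
      simp only [machineCode, Turing.TM2.stepAux]
      rw [show Stk.contents (N := N) (a :: l) S .inp = a :: l from rfl, List.tail_cons,
        Stk.update_contents_inp, Stk.contents_reg _ _ (Nat.zero_le _),
        Stk.contents_update _ _ (Nat.zero_le _)]
      rfl
    · simpa using h

/-- Loading an input of length `n` takes `n + 1` steps and writing the answer takes one, whence the
summand `X + 2`. The run must leave every stack except stack `1` empty, since Mathlib's halting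
configuration has nothing but the output on its stacks. -/
theorem polyTimeDecidable_of_run {α : Type} [Finite X] [Finite G] (enc : α → List X) (P : α → Prop)
    (g₀ : G) (emb : X → G) (p : Prog G) (q : Polynomial ℕ) (V : List X → Bool)
    (hp : ∀ l : List X, ∃ t ≤ q.eval l.length,
      Run p (update (fun _ => []) 0 (l.map emb).reverse)
        (update (fun _ => []) 1 (if V l then [g₀] else [])) t)
    (hV : ∀ a, V (enc a) = true ↔ P a) : PolyTimeDecidable enc P := by
  obtain ⟨N, hN⟩ := p.exists_uses
  -- The answer is read from stack `1`, which must exist even if the program only uses stack `0`.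
  replace hN : p.Uses (N + 1) := hN.mono (by omega)
  refine ⟨fun a => V (enc a), hV, ⟨⟨p.machine (N + 1) g₀ emb, Equiv.refl _, Equiv.refl _⟩,
    q + Polynomial.X + Polynomial.C 2, fun a => ?_⟩, ?_⟩
  · have key : ∃ t ≤ (q + Polynomial.X + Polynomial.C 2).eval (enc a).length,
        ReachesIn (p.machine (N + 1) g₀ emb).step t
          (Turing.initList (p.machine (N + 1) g₀ emb) (enc a))
          (Turing.haltList (p.machine (N + 1) g₀ emb) (Computability.encodeBool (V (enc a)))) := by
      obtain ⟨t, ht, hr⟩ := hp (enc a)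
      obtain ⟨v₁, h₁⟩ := p.reachesIn_input (N := N + 1) g₀ emb (enc a) (fun _ => []) none
      simp only [List.append_nil] at h₁
      obtain ⟨v₂, h₂⟩ := Prog.reachesIn_code (p.machineCode (N + 1) g₀ emb) [] hr hN .inl
        (.inr true) (fun l => rfl) v₁
      refine ⟨(enc a).length + 1 + t + 1, ?_, ?_⟩
      · simp only [Polynomial.eval_add, Polynomial.eval_X, Polynomial.eval_C]
        omega
      · have h₃ : ReachesIn (Turing.TM2.step (p.machineCode (N + 1) g₀ emb)) 1
            ⟨some (.inr true), v₂, Stk.contents []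
              (update (fun _ => []) 1 (if V (enc a) then [g₀] else []))⟩
            (Turing.haltList (p.machine (N + 1) g₀ emb)
              (Computability.encodeBool (V (enc a)))) := by
          refine .single ?_
          rw [Turing.TM2.step]
          simp only [Prog.machineCode, Turing.TM2.stepAux]
          rw [Stk.contents_reg _ _ (by omega), Stk.contents_update _ _ (by omega)]
          unfold Turing.haltList
          congr 2
          funext k
          cases k with
          | inp => rfl
          | reg i =>
            rw [update_of_ne (by simp)]
            cases V (enc a) <;> by_cases h : (i : ℕ) = 1 <;>
              simp [Stk.contents, h, Prog.machine]
          | out =>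
            cases h : V (enc a) <;> simp [Stk.contents, Prog.machine] <;> rfl
        refine ReachesIn.trans ?_ h₃
        refine ReachesIn.trans ?_ h₂
        have h₀ : Turing.initList (p.machine (N + 1) g₀ emb) (enc a) =
            (⟨some (.inr false), none, Stk.contents (enc a) fun _ => []⟩ :
              Turing.TM2.Cfg (Stk.Alphabet X G (N := N + 1)) (p.Label ⊕ Bool) (Option G)) := by
          unfold Turing.initList
          congr 1
          funext k
          cases k <;> rfl
        rw [h₀]
        exact h₁
    -- The number of steps is data here, so it is chosen from the existential statement. Input and
    -- output alphabets are identified by `Equiv.refl`, which leaves a `List.map` of the identity to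
    -- be removed.
    exact ⟨⟨key.choose, by
      have := key.choose_spec.2
      unfold ReachesIn at this
      exact (congrArg (fun l => (flip bind (p.machine (N + 1) g₀ emb).step)^[key.choose]
        (some (Turing.initList (p.machine (N + 1) g₀ emb) l))) (List.map_id (enc a))).trans
        (this.trans (congrArg (fun l => some (Turing.haltList (p.machine (N + 1) g₀ emb) l))
          (List.map_id _).symm))⟩, key.choose_spec.1⟩
  · rintro (_ | _ | _)
    · exact inferInstanceAs (Finite X)
    · exact inferInstanceAs (Finite Bool)
    · exact inferInstanceAs (Finite G)

end

end TAssembly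

namespace TAssembly

open Function

variable {G : Type}

/-! ### Functions computed by programs in polynomial time -/

/-- The coefficients are natural numbers, so no term can decrease. -/
theorem eval_mono (q : Polynomial ℕ) {m n : ℕ} (h : m ≤ n) : q.eval m ≤ q.eval n := by
  simp only [Polynomial.eval_eq_sum, Polynomial.sum]
  gcongr

/-- `p` turns `S` into `S'` in at most `T` steps. -/
def Runs (p : Prog G) (S S' : Env G) (T : ℕ) : Prop := ∃ t ≤ T, Run p S S' t

theorem Runs.mono {p : Prog G} {S S' : Env G} {T T' : ℕ} (h : Runs p S S' T) (hT : T ≤ T') :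
    Runs p S S' T' := by
  obtain ⟨t, ht, hr⟩ := h
  exact ⟨t, ht.trans hT, hr⟩

theorem Runs.seq {p q : Prog G} {S S' S'' : Env G} {T T' : ℕ} (h : Runs p S S' T)
    (h' : Runs q S' S'' T') : Runs (.seq p q) S S'' (T + T') := by
  obtain ⟨t, ht, hr⟩ := h
  obtain ⟨t', ht', hr'⟩ := h'
  exact ⟨t + t', by omega, .seq hr hr'⟩

theorem Runs.skip (S : Env G) : Runs .skip S S 1 := ⟨1, le_refl 1, .skip S⟩

theorem Runs.push (k : ℕ) (g : G) (S : Env G) : Runs (.push k g) S (update S k (g :: S k)) 1 :=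
  ⟨1, le_refl 1, .push k g S⟩

theorem Runs.pop_nil {k : ℕ} {p : Prog G} {f : G → Prog G} {S S' : Env G} {T : ℕ} (hS : S k = [])
    (h : Runs p S S' T) : Runs (.pop k p f) S S' (1 + T) := by
  obtain ⟨t, ht, hr⟩ := h
  exact ⟨1 + t, by omega, .pop_nil hS hr⟩

theorem Runs.pop_cons {k : ℕ} {p : Prog G} {f : G → Prog G} {S S' : Env G} {T : ℕ} {g : G}
    {l : List G} (hS : S k = g :: l) (h : Runs (f g) (update S k l) S' T) :
    Runs (.pop k p f) S S' (1 + T) := by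
  obtain ⟨t, ht, hr⟩ := h
  exact ⟨1 + t, by omega, .pop_cons hS hr⟩

theorem Runs.loop_nil {k : ℕ} {f : G → Prog G} {S : Env G} (hS : S k = []) :
    Runs (.loop k f) S S 1 := ⟨1, le_refl 1, .loop_nil hS⟩

theorem Runs.loop_cons {k : ℕ} {f : G → Prog G} {S S' S'' : Env G} {T T' : ℕ} {g : G}
    {l : List G} (hS : S k = g :: l) (h : Runs (f g) (update S k l) S' T)
    (h' : Runs (.loop k f) S' S'' T') : Runs (.loop k f) S S'' (1 + (T + T')) := by
  obtain ⟨t, ht, hr⟩ := h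
  obtain ⟨t', ht', hr'⟩ := h'
  exact ⟨1 + (t + t'), by omega, .loop_cons hS hr hr'⟩

theorem Runs.of_eq {p : Prog G} {S S' S'' : Env G} {T T' : ℕ} (h : Runs p S S' T) (hS : S' = S'')
    (hT : T ≤ T') : Runs p S S'' T' := hS ▸ h.mono hT

theorem runs_loop_push {k k' : ℕ} (hk : k ≠ k') (l : List G) (S : Env G) (hS : S k = l) :
    Runs (.loop k fun g => .push k' g) S (update (update S k []) k' (l.reverse ++ S k'))
      (2 * l.length + 1) := by
  induction l generalizing S with
  | nil =>
    refine (Runs.loop_nil hS).of_eq ?_ (by simp)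
    have hS' : update S k [] = S := update_eq_self_iff.2 hS.symm
    simp [hS']
  | cons a l ih =>
    refine (Runs.loop_cons hS (Runs.push k' a _) (ih _ (by simp [hk]))).of_eq ?_ ?_
    · funext j
      by_cases h1 : j = k' <;> by_cases h2 : j = k <;> simp_all [update_apply]
    · simp; omega

theorem runs_loop_push_push {k k' m : ℕ} (hk : k ≠ k') (hm : k ≠ m) (hkm : k' ≠ m) (l : List G)
    (S : Env G) (hS : S k = l) :
    Runs (.loop k fun g => .seq (.push k' g) (.push m g)) S
      (update (update (update S k []) k' (l.reverse ++ S k')) m (l.reverse ++ S m))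
      (3 * l.length + 1) := by
  induction l generalizing S with
  | nil =>
    refine (Runs.loop_nil hS).of_eq ?_ (by simp)
    have hS' : update S k [] = S := update_eq_self_iff.2 hS.symm
    simp [hS']
  | cons a l ih =>
    refine (Runs.loop_cons hS ((Runs.push k' a _).seq (Runs.push m a _))
      (ih _ (by simp [hk, hm]))).of_eq ?_ ?_
    · funext j
      by_cases h1 : j = k' <;> by_cases h2 : j = k <;> by_cases h3 : j = m <;>
        simp_all [update_apply]
    · simp; omega

/-- Empties the stack `k`. -/
def Prog.clear (k : ℕ) : Prog G := .loop k fun _ => .skip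

theorem runs_clear (k : ℕ) (S : Env G) :
    Runs (.clear k) S (update S k []) (2 * (S k).length + 1) := by
  generalize hl : S k = l
  induction l generalizing S with
  | nil => exact (Runs.loop_nil hl).of_eq (update_eq_self_iff.2 hl.symm).symm (by simp)
  | cons a l ih =>
    refine (Runs.loop_cons hl (Runs.skip _) (ih _ (by simp))).of_eq (by simp) ?_
    rw [List.length_cons]
    omega

/-- Copies the stack `i` to the stack `o`, by means of the stack `t`. -/
def Prog.copy (i o t : ℕ) : Prog G :=
  .seq (.loop i fun g => .push t g) (.loop t fun g => .seq (.push i g) (.push o g))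

/-- Moving a stack to `t` reverses it; moving it back reverses it again, and on the way back each
symbol is pushed twice. -/
theorem runs_copy {i o t : ℕ} (hio : i ≠ o) (hit : i ≠ t) (hot : o ≠ t) (S : Env G)
    (ho : S o = []) (ht : S t = []) :
    Runs (.copy i o t) S (update S o (S i)) (5 * (S i).length + 2) := by
  have h₁ := runs_loop_push hit (S i) S rfl
  have h₂ := runs_loop_push_push hit.symm hot.symm hio ((S i).reverse)
    (update (update S i []) t ((S i).reverse ++ S t)) (by simp [ht])
  refine (h₁.seq h₂).of_eq ?_ (by simp; omega)
  funext j
  by_cases h1 : j = i <;> by_cases h2 : j = o <;> by_cases h3 : j = t <;>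
    simp_all [update_apply]

/-- The contents `S` with the stacks `o`, …, `o + w - 1` replaced by `e 0`, …, `e (w - 1)`. -/
def wr (S : Env G) (o w : ℕ) (e : ℕ → List G) : Env G :=
  fun j => if o ≤ j ∧ j < o + w then e (j - o) else S j

theorem wr_of_lt {S : Env G} {o w j : ℕ} {e : ℕ → List G} (h : j < o) : wr S o w e j = S j :=
  if_neg (by omega)

theorem wr_of_ge {S : Env G} {o w j : ℕ} {e : ℕ → List G} (h : o + w ≤ j) :
    wr S o w e j = S j := if_neg (by omega)

theorem wr_add {S : Env G} {o w j : ℕ} {e : ℕ → List G} (h : j < w) :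
    wr S o w e (o + j) = e j := by
  unfold wr
  rw [if_pos (by omega), Nat.add_sub_cancel_left]

theorem wr_of_mem {S : Env G} {o w j : ℕ} {e : ℕ → List G} (h : o ≤ j) (h' : j < o + w) :
    wr S o w e j = e (j - o) := if_pos ⟨h, h'⟩

/-- Empties the stacks `o`, …, `o + w - 1`. -/
def Prog.clearBlock (o : ℕ) : ℕ → Prog G
  | 0 => .skip
  | w + 1 => .seq (Prog.clearBlock o w) (.clear (o + w))

theorem runs_clearBlock (o w : ℕ) (S : Env G) :
    Runs (.clearBlock o w) S (wr S o w fun _ => [])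
      (2 * ∑ j ∈ Finset.range w, (S (o + j)).length + w + 1) := by
  induction w with
  | zero => exact (Runs.skip S).of_eq (funext fun j => (if_neg (by omega)).symm) (by omega)
  | succ w ih =>
    refine (ih.seq (runs_clear (o + w) _)).of_eq ?_ ?_
    · funext j
      by_cases hj : j = o + w
      · subst hj; simp [wr]
      · simp only [wr, update_of_ne hj]
        exact if_congr (by omega) rfl rfl
    · rw [wr_of_ge le_rfl, Finset.sum_range_succ]; omega

/-- Copies the stacks `i`, …, `i + w - 1` to `o`, …, `o + w - 1`, by means of the stack `t`. -/
def Prog.copyBlock (i o t : ℕ) : ℕ → Prog G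
  | 0 => .skip
  | w + 1 => .seq (Prog.copyBlock i o t w) (.copy (i + w) (o + w) t)

theorem runs_copyBlock {i o t w : ℕ} (hio : i + w ≤ o ∨ o + w ≤ i) (hi : i + w ≤ t)
    (ho : o + w ≤ t) (S : Env G) (hSo : ∀ j < w, S (o + j) = []) (hSt : S t = []) :
    Runs (.copyBlock i o t w) S (wr S o w fun j => S (i + j))
      (5 * ∑ j ∈ Finset.range w, (S (i + j)).length + 2 * w + 1) := by
  induction w with
  | zero => exact (Runs.skip S).of_eq (funext fun j => (if_neg (by omega)).symm) (by omega)
  | succ w ih =>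
    have h := ih (by omega) (by omega) (by omega) fun j hj => hSo j (by omega)
    have hi' : wr S o w (fun j => S (i + j)) (i + w) = S (i + w) := if_neg (by omega)
    refine (h.seq (runs_copy (i := i + w) (o := o + w) (t := t) (by omega) (by omega) (by omega) _
      ?_ ?_)).of_eq ?_ ?_
    · rw [wr_of_ge le_rfl, hSo w (by omega)]
    · rw [wr_of_ge (by omega), hSt]
    · funext j
      rw [hi']
      by_cases hj : j = o + w
      · subst hj; simp [wr]
      · simp only [wr, update_of_ne hj]
        exact if_congr (by omega) rfl rfl
    · rw [hi', Finset.sum_range_succ]; omega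

/-! ### Data on blocks of stacks; composition and pairing -/

variable (G) in
/-- The representation of the elements of `α` by blocks of stacks. -/
class StackRep (α : Type) where
  /-- The number of stacks. -/
  width : ℕ
  /-- The contents of the stacks. -/
  enc : α → ℕ → List G

open StackRep

section

variable {α β γ σ : Type} [StackRep G α] [StackRep G β] [StackRep G γ] [StackRep G σ]

variable (G) in
/-- The number of symbols in the representation of an element. -/
def size (a : α) : ℕ := ∑ j ∈ Finset.range (width G α), (enc (G := G) a j).length

/-- The stacks from number `i` on hold the representation of `a`. -/
def Holds (S : Env G) (i : ℕ) (a : α) : Prop := ∀ j < width G α, S (i + j) = enc a j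

theorem Holds.sum_eq {S : Env G} {i : ℕ} {a : α} (h : Holds S i a) :
    ∑ j ∈ Finset.range (width G α), (S (i + j)).length = size G a :=
  Finset.sum_congr rfl fun j hj => by rw [h j (Finset.mem_range.1 hj)]

theorem holds_wr (S : Env G) (i : ℕ) (a : α) : Holds (wr S i (width G α) (enc a)) i a :=
  fun _ hj => wr_add hj

theorem Holds.wr {S : Env G} {i o w : ℕ} {a : α} {e : ℕ → List G} (h : Holds S i a)
    (hio : i + width G α ≤ o ∨ o + w ≤ i) : Holds (wr S o w e) i a := fun j hj => by
  rw [← h j hj]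
  exact if_neg (by omega)

variable (G) in
/-- `f` is computed in polynomial time by programs, which read the argument from the stacks from
number `i` on and write the value to the stacks from number `o` on. The stacks from number `b` on
are used for auxiliary purposes: they are empty at the beginning and at the end. -/
def Comp (f : α → β) : Prop :=
  ∃ q : Polynomial ℕ, (∀ a, size G (f a) ≤ q.eval (size G a)) ∧
    ∀ i o b, i + width G α ≤ b → o + width G β ≤ b → (i + width G α ≤ o ∨ o + width G β ≤ i) →
      ∃ p : Prog G, ∀ S a, Holds S i a → (∀ j < width G β, S (o + j) = []) →
        (∀ j, b ≤ j → S j = []) →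
        Runs p S (wr S o (width G β) (enc (f a))) (q.eval (size G a))

/-- The intermediate value lives in a block at `b`, with the auxiliary stacks of both programs moved
beyond it. Clearing the block at the end accounts for the term `2 * qf`. -/
theorem Comp.comp {g : β → γ} {f : α → β} (hg : Comp G g) (hf : Comp G f) :
    Comp G fun a => g (f a) := by
  obtain ⟨qf, hqf, hf⟩ := hf
  obtain ⟨qg, hqg, hg⟩ := hg
  refine ⟨qf + qg.comp qf + Polynomial.C 2 * qf + Polynomial.C (width G β + 1), fun a => ?_,
    fun i o b hi ho hio => ?_⟩
  · have := (hqg (f a)).trans (eval_mono qg (hqf a))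
    simp only [Polynomial.eval_add, Polynomial.eval_comp]
    omega
  · obtain ⟨pf, hpf⟩ := hf i b (b + width G β) (by omega) le_rfl (by omega)
    obtain ⟨pg, hpg⟩ := hg b o (b + width G β) le_rfl (by omega) (by omega)
    refine ⟨.seq (.seq pf pg) (.clearBlock b (width G β)), fun S a hS hSo hSb => ?_⟩
    have h₁ := hpf S a hS (fun j _ => hSb _ (by omega)) fun j hj => hSb j (by omega)
    have h₂ := hpg _ (f a) (holds_wr S b (f a))
      (fun j hj => by rw [wr_of_lt (by omega), hSo j hj])
      (fun j hj => by rw [wr_of_ge hj, hSb j (by omega)])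
    have h₃ := runs_clearBlock b (width G β)
      (wr (wr S b (width G β) (enc (f a))) o (width G γ) (enc (g (f a))))
    rw [((holds_wr S b (f a)).wr (Or.inr ho)).sum_eq] at h₃
    refine ((h₁.seq h₂).seq h₃).of_eq ?_ ?_
    · funext j
      simp only [wr]
      split_ifs <;> first | rfl | omega | skip
      exact (hSb j (by omega)).symm
    · have h₄ := eval_mono qg (hqf a)
      have h₅ := hqf a
      simp only [Polynomial.eval_add, Polynomial.eval_comp, Polynomial.eval_mul, Polynomial.eval_C]
      omega

/-- Covers every function whose value is already present as a sub-block of the argument: the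
identity, projections, and changes of type that keep the representation. -/
theorem Comp.of_copy {f : α → β} (k : ℕ) (hk : k + width G β ≤ width G α)
    (hf : ∀ a, ∀ j < width G β, enc (G := G) (f a) j = enc a (k + j)) : Comp G f := by
  have hsize : ∀ a, size G (f a) ≤ size G a := fun a => by
    unfold size
    rw [← Nat.sub_add_cancel hk, Nat.add_comm, Nat.add_assoc, Finset.sum_range_add,
      Finset.sum_range_add, Finset.sum_congr rfl fun j hj => by rw [hf a j (Finset.mem_range.1 hj)]]
    omega
  refine ⟨Polynomial.C 5 * Polynomial.X + Polynomial.C (2 * width G β + 1), fun a => ?_,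
    fun i o b hi ho hio => ⟨.copyBlock (i + k) o b (width G β), fun S a hS hSo hSb => ?_⟩⟩
  · have := hsize a
    simp only [Polynomial.eval_add, Polynomial.eval_mul, Polynomial.eval_C, Polynomial.eval_X]
    omega
  · have hS' : Holds S (i + k) (f a) := fun j hj => by
      rw [hf a j hj, Nat.add_assoc, hS (k + j) (by omega)]
    refine (runs_copyBlock (by omega) (by omega) (by omega) S hSo (hSb b le_rfl)).of_eq ?_ ?_
    · funext j
      unfold wr
      split_ifs with h
      · exact hS' (j - o) (by omega)
      · rfl
    · have := hsize a
      rw [hS'.sum_eq]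
      simp only [Polynomial.eval_add, Polynomial.eval_mul, Polynomial.eval_C, Polynomial.eval_X]
      omega

theorem Comp.id : Comp G fun a : α => a :=
  .of_copy 0 (by omega) fun a j _ => by rw [Nat.zero_add]

instance : StackRep G (α × β) where
  width := width G α + width G β
  enc p j := if j < width G α then enc p.1 j else enc p.2 (j - width G α)

theorem width_prod : width G (α × β) = width G α + width G β := rfl

theorem enc_prod_left (p : α × β) {j : ℕ} (hj : j < width G α) :
    enc (G := G) p j = enc p.1 j := if_pos hj

theorem enc_prod_right (p : α × β) (j : ℕ) :
    enc (G := G) p (width G α + j) = enc p.2 j := by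
  simp [enc]

theorem size_prod (a : α) (b : β) : size G (a, b) = size G a + size G b := by
  unfold size
  rw [width_prod, Finset.sum_range_add]
  congr 1
  · exact Finset.sum_congr rfl fun j hj => by rw [enc_prod_left _ (Finset.mem_range.1 hj)]
  · exact Finset.sum_congr rfl fun j hj => by rw [enc_prod_right]

theorem Comp.fst' : Comp G fun p : α × β => p.1 :=
  .of_copy 0 (by rw [width_prod]; omega) fun p j hj => by
    rw [Nat.zero_add, enc_prod_left _ hj]

theorem Comp.snd' : Comp G fun p : α × β => p.2 :=
  .of_copy (width G α) (by rw [width_prod]) fun p j hj => by rw [enc_prod_right]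

theorem Comp.fst {f : α → β × γ} (hf : Comp G f) : Comp G fun a => (f a).1 := Comp.fst'.comp hf

theorem Comp.snd {f : α → β × γ} (hf : Comp G f) : Comp G fun a => (f a).2 := Comp.snd'.comp hf

theorem Comp.pair {f : α → β} {g : α → γ} (hf : Comp G f) (hg : Comp G g) :
    Comp G fun a => (f a, g a) := by
  obtain ⟨qf, hqf, hf⟩ := hf
  obtain ⟨qg, hqg, hg⟩ := hg
  refine ⟨qf + qg, fun a => ?_, fun i o b hi ho hio => ?_⟩
  · rw [size_prod, Polynomial.eval_add]
    exact add_le_add (hqf a) (hqg a)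
  · rw [width_prod] at ho hio
    obtain ⟨pf, hpf⟩ := hf i o b hi (by omega) (by omega)
    obtain ⟨pg, hpg⟩ := hg i (o + width G β) b hi (by omega) (by omega)
    refine ⟨.seq pf pg, fun S a hS hSo hSb => ?_⟩
    rw [width_prod] at hSo
    have h₁ := hpf S a hS (fun j hj => hSo j (by omega)) hSb
    have h₂ := hpg _ a (hS.wr (o := o) (w := width G β) (e := enc (f a)) (by omega))
      (fun j hj => by rw [wr_of_ge (by omega), Nat.add_assoc, hSo _ (by omega)])
      (fun j hj => by rw [wr_of_ge (by omega), hSb j hj])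
    refine (h₁.seq h₂).of_eq ?_ (by rw [Polynomial.eval_add])
    funext j
    rw [width_prod]
    rcases lt_or_ge j (o + width G β) with h | h
    · rw [wr_of_lt h]
      rcases lt_or_ge j o with h' | h'
      · rw [wr_of_lt h', wr_of_lt h']
      · rw [wr_of_mem h' h, wr_of_mem h' (by omega), enc_prod_left _ (by omega)]
    · rcases lt_or_ge j (o + (width G β + width G γ)) with h' | h'
      · rw [wr_of_mem h (by omega), wr_of_mem (by omega) h',
          show j - o = width G β + (j - (o + width G β)) by omega, enc_prod_right]
      · rw [wr_of_ge (by omega), wr_of_ge h, wr_of_ge h']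

end

end TAssembly

namespace TAssembly

open Function StackRep

variable {G : Type}

/-! ### Strings, truth values and loops -/

variable (G) in
/-- The symbols in `C` are represented by symbols in `G`. -/
class Emb (C : Type) where
  /-- The representation of a symbol. -/
  emb : C → G
  /-- The inverse. -/
  inv : G → Option C
  inv_emb : ∀ c, inv (emb c) = some c

open Emb

instance {C : Type} [Emb G C] : StackRep G (List C) where
  width := 1
  enc l _ := l.map emb

instance [Inhabited G] : StackRep G Bool where
  width := 1
  enc b _ := if b then [default] else []

variable {α β γ σ C : Type} [StackRep G α] [StackRep G β] [StackRep G γ] [StackRep G σ] [Emb G C]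

theorem width_list : width G (List C) = 1 := rfl

theorem enc_list (l : List C) (j : ℕ) : enc (G := G) l j = l.map emb := rfl

@[simp] theorem size_list (l : List C) : size G l = l.length := by
  simp [size, width_list, enc_list]

theorem width_bool [Inhabited G] : width G Bool = 1 := rfl

theorem size_bool_le [Inhabited G] (b : Bool) : size G b ≤ 1 := by
  cases b <;> simp [size, width_bool, enc]

theorem Comp.nil : Comp G fun _ : α => ([] : List C) := by
  refine ⟨Polynomial.C 1, fun a => by simp, fun i o b _ _ _ => ⟨.skip, fun S a _ hSo _ => ?_⟩⟩
  refine (Runs.skip S).of_eq (funext fun j => ?_) (by simp)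
  unfold wr
  split_ifs with h
  · rw [width_list] at h
    obtain rfl : j = o := by omega
    simpa [enc_list] using hSo 0 (by simp [width_list])
  · rfl

theorem wr_one (S : Env G) (o : ℕ) (e : ℕ → List G) : wr S o 1 e = update S o (e 0) := by
  funext j
  by_cases h : j = o
  · subst h; simp [wr]
  · rw [update_of_ne h]
    exact if_neg (by omega)

theorem Comp.cons_const (c : C) {f : α → List C} (hf : Comp G f) : Comp G fun a => c :: f a := by
  obtain ⟨q, hq, hf⟩ := hf
  refine ⟨q + Polynomial.C 1, fun a => ?_, fun i o b hi ho hio => ?_⟩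
  · simpa using hq a
  · obtain ⟨p, hp⟩ := hf i o b hi ho hio
    refine ⟨.seq p (.push o (emb c)), fun S a hS hSo hSb => ?_⟩
    refine ((hp S a hS hSo hSb).seq (Runs.push o (emb c) _)).of_eq ?_ (by simp)
    simp [width_list, wr_one, enc_list]

theorem Comp.const_false [Inhabited G] : Comp G fun _ : α => false := by
  refine ⟨Polynomial.C 1, fun a => ?_, fun i o b _ _ _ => ⟨.skip, fun S a _ hSo _ => ?_⟩⟩
  · simpa using size_bool_le (G := G) false
  refine (Runs.skip S).of_eq ?_ (by simp)
  rw [width_bool, wr_one]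
  exact (update_eq_self_iff.2 (hSo 0 (by simp [width_bool])).symm).symm

theorem Comp.const_true [Inhabited G] : Comp G fun _ : α => true := by
  refine ⟨Polynomial.C 1, fun a => ?_,
    fun i o b _ _ _ => ⟨.push o default, fun S a _ hSo _ => ?_⟩⟩
  · simpa using size_bool_le (G := G) true
  refine (Runs.push o default S).of_eq ?_ (by simp)
  rw [width_bool, wr_one]
  have := hSo 0 (by simp [width_bool])
  simp only [Nat.add_zero] at this
  rw [this]
  rfl

/-- The condition is computed on the empty stack `b`. Popping it both selects the branch and empties
the stack again. -/
theorem Comp.ite [Inhabited G] {c : α → Bool} {f g : α → β} (hc : Comp G c) (hf : Comp G f)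
    (hg : Comp G g) : Comp G fun a => if c a then f a else g a := by
  obtain ⟨qc, hqc, hc⟩ := hc
  obtain ⟨qf, hqf, hf⟩ := hf
  obtain ⟨qg, hqg, hg⟩ := hg
  refine ⟨qc + qf + qg + Polynomial.C 1, fun a => ?_, fun i o b hi ho hio => ?_⟩
  · simp only [Polynomial.eval_add]
    have := hqf a
    have := hqg a
    split_ifs <;> omega
  · obtain ⟨pc, hpc⟩ := hc i b (b + 1) (by omega) (by rw [width_bool]) (by omega)
    obtain ⟨pf, hpf⟩ := hf i o b hi ho hio
    obtain ⟨pg, hpg⟩ := hg i o b hi ho hio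
    refine ⟨.seq pc (.pop b pg fun _ => pf), fun S a hS hSo hSb => ?_⟩
    have h₁ := hpc S a hS (fun j hj => hSb _ (by omega)) (fun j hj => hSb j (by omega))
    rw [width_bool, wr_one] at h₁
    have hSb' : S b = [] := hSb b le_rfl
    cases h : c a with
    | false =>
      rw [h] at h₁
      have h₂ : update S b (enc (G := G) false 0) = S := update_eq_self_iff.2 hSb'.symm
      rw [h₂] at h₁
      refine (h₁.seq (Runs.pop_nil hSb' (hpg S a hS hSo hSb))).of_eq (by simp [h]) ?_
      simp only [Polynomial.eval_add, Polynomial.eval_C]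
      omega
    | true =>
      rw [h] at h₁
      refine (h₁.seq (Runs.pop_cons (g := default) (l := []) (update_self ..) ?_)).of_eq
        (T := _ + (1 + qf.eval (size G a))) (S' := wr S o (width G β) (enc (f a))) (by simp [h]) ?_
      · rw [update_idem, update_eq_self_iff.2 hSb'.symm]
        exact hpf S a hS hSo hSb
      · simp only [Polynomial.eval_add, Polynomial.eval_C]
        omega

/-- The sum over the finite alphabet bounds each summand, so one polynomial serves all branches. -/
theorem exists_forall_eval_le [Finite C] (q : C → Polynomial ℕ) :
    ∃ Q : Polynomial ℕ, ∀ c n, (q c).eval n ≤ Q.eval n := by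
  have := Fintype.ofFinite C
  refine ⟨∑ c, q c, fun c n => ?_⟩
  rw [Polynomial.eval_finsetSum]
  exact Finset.single_le_sum (f := fun c => (q c).eval n) (fun _ _ => Nat.zero_le _)
    (Finset.mem_univ c)

theorem wr_pair_list (S : Env G) (b : ℕ) (a : α) (l l' : List C) :
    update (wr S b (width G (α × List C)) (enc (a, l))) (b + width G α) (l'.map emb) =
      wr S b (width G (α × List C)) (enc (a, l')) := by
  funext j
  by_cases h : j = b + width G α
  · subst h
    rw [update_self, wr_add (by simp [width_prod, width_list]), ← Nat.add_zero (width G α),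
      enc_prod_right]
    rfl
  · rw [update_of_ne h]
    unfold wr
    split_ifs with h'
    · rw [width_prod, width_list] at h'
      rw [enc_prod_left _ (by omega), enc_prod_left _ (by omega)]
    · rfl

theorem wr_pair_list_apply (S : Env G) (b : ℕ) (a : α) (l : List C) :
    wr S b (width G (α × List C)) (enc (a, l)) (b + width G α) = l.map emb := by
  rw [wr_add (by simp [width_prod, width_list]), ← Nat.add_zero (width G α), enc_prod_right]
  rfl

/-- The empty stacks from number `b` on are not affected by filling and clearing. -/
theorem wr_clear {S : Env G} {b w : ℕ} {e : ℕ → List G} (hSb : ∀ j, b ≤ j → S j = []) :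
    wr (wr S b w e) b w (fun _ => []) = S := by
  funext j
  unfold wr
  split_ifs with h
  · exact (hSb j h.1).symm
  · rfl

theorem wr_comm {S : Env G} {o b w w' : ℕ} {e e' : ℕ → List G} (h : o + w ≤ b ∨ b + w' ≤ o) :
    wr (wr S b w' e') o w e = wr (wr S o w e) b w' e' := by
  funext j
  unfold wr
  split_ifs <;> first | rfl | omega

/-- A pop on a copy of the pair of argument and list exposes the first symbol and leaves exactly the
pair of argument and tail. The symbol then selects one of finitely many programs. -/
theorem Comp.listCase [Finite C] {l : α → List C} {n : α → β} {h : α → C → List C → β}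
    (hl : Comp G l) (hn : Comp G n) (hh : ∀ c, Comp G fun p : α × List C => h p.1 c p.2) :
    Comp G fun a => match l a with
      | [] => n a
      | c :: t => h a c t := by
  obtain ⟨q₀, hq₀, h₀⟩ := Comp.id.pair hl
  obtain ⟨qn, hqn, hn⟩ := hn
  choose qc hqc hc using hh
  obtain ⟨Q, hQ⟩ := exists_forall_eval_le qc
  refine ⟨q₀ + Q.comp q₀ + qn + Polynomial.C 2 * q₀ + Polynomial.C (width G (α × List C) + 2),
    fun a => ?_, fun i o b hi ho hio => ?_⟩
  · have h₁ := hq₀ a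
    rw [size_prod, size_list] at h₁
    simp only [Polynomial.eval_add, Polynomial.eval_comp]
    split
    · have := hqn a
      omega
    · next c t hl =>
      have h₂ := hqc c (a, t)
      have h₃ := hQ c (size G (a, t))
      have h₄ : size G (a, t) ≤ q₀.eval (size G a) := by
        rw [size_prod, size_list]
        rw [hl, List.length_cons] at h₁
        omega
      have h₅ := eval_mono Q h₄
      simp only at h₂
      omega
  · set w := width G (α × List C) with hw
    have hw' : w = width G α + 1 := rfl
    obtain ⟨p₀, hp₀⟩ := h₀ i b (b + w) (by omega) le_rfl (by omega)
    obtain ⟨pn, hpn⟩ := hn i o (b + w) (by omega) (by omega) hio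
    choose pc hpc using fun c => hc c b o (b + w) le_rfl (by omega) (by omega)
    -- Only representations of symbols of `C` occur on this stack; `skip` is a default for the other
    -- symbols of `G`.
    refine ⟨.seq (.seq p₀ (.pop (b + width G α) pn fun g => (inv (C := C) g).elim .skip pc))
      (.clearBlock b w), fun S a hS hSo hSb => ?_⟩
    have r₀ := hp₀ S a hS (fun j _ => hSb _ (by omega)) (fun j hj => hSb j (by omega))
    have hs := hq₀ a
    simp only at r₀ hs
    have hclear : ∀ l' : List C, size G (a, l') ≤ q₀.eval (size G a) →
        ∀ e, Runs (.clearBlock b w) (wr (wr S b w (enc (a, l'))) o (width G β) e)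
        (wr S o (width G β) e) (2 * q₀.eval (size G a) + w + 1) := fun l' hl' e => by
      refine (runs_clearBlock b w _).of_eq ?_ ?_
      · rw [wr_comm (by omega), wr_clear hSb]
      · rw [((holds_wr S b (a, l')).wr (Or.inr ho)).sum_eq]
        omega
    cases hla : l a with
    | nil =>
      rw [hla] at r₀ hs
      have r₁ := hpn _ a (hS.wr (o := b) (w := w) (e := enc (a, ([] : List C))) (by omega))
        (fun j hj => by rw [wr_of_lt (by omega), hSo j hj])
        (fun j hj => by rw [wr_of_ge hj, hSb j (by omega)])
      refine ((r₀.seq (Runs.pop_nil (wr_pair_list_apply ..) r₁)).seq (hclear [] hs _)).of_eq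
        (by simp only [hla]) ?_
      simp only [Polynomial.eval_add, Polynomial.eval_comp, Polynomial.eval_mul, Polynomial.eval_C]
      omega
    | cons c t =>
      rw [hla] at r₀ hs
      have hs' : size G (a, t) ≤ q₀.eval (size G a) := by
        rw [size_prod, size_list] at hs ⊢
        rw [List.length_cons] at hs
        omega
      have r₁ := hpc c _ (a, t) (holds_wr S b (a, t))
        (fun j hj => by rw [wr_of_lt (by omega), hSo j hj])
        (fun j hj => by rw [wr_of_ge hj, hSb j (by omega)])
      refine ((r₀.seq (Runs.pop_cons (g := emb c) (l := t.map emb) (wr_pair_list_apply ..)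
        (T := (qc c).eval (size G (a, t))) ?_)).seq (hclear t hs' (enc (h a c t)))).of_eq
        (by simp only [hla]) ?_
      · rw [wr_pair_list, inv_emb]
        exact r₁
      · have h₃ := hQ c (size G (a, t))
        have h₅ := eval_mono Q hs'
        simp only [Polynomial.eval_add, Polynomial.eval_comp, Polynomial.eval_mul,
          Polynomial.eval_C]
        omega

/-- The stacks of the program for a loop: a parameter `a`, a state `x` and a string `t`. -/
def loopEnv (S : Env G) (b : ℕ) (a : α) (x : σ) (t : List C) : Env G :=
  wr S b (width G ((α × σ) × List C)) (enc ((a, x), t))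

theorem loopEnv_param (S : Env G) (b : ℕ) (a : α) (x : σ) (t : List C) :
    Holds (loopEnv S b a x t) b (a, x) := fun j hj => by
  unfold loopEnv
  rw [wr_add (by rw [width_prod]; omega), enc_prod_left _ hj]

theorem loopEnv_state (S : Env G) (b : ℕ) (a : α) (x : σ) (t : List C) :
    Holds (loopEnv S b a x t) (b + width G α) x := fun j hj => by
  rw [Nat.add_assoc, loopEnv_param S b a x t _ (by rw [width_prod]; omega), enc_prod_right]

theorem loopEnv_update (S : Env G) (b : ℕ) (a : α) (x x' : σ) (t : List C) :
    wr (loopEnv S b a x t) (b + width G α) (width G σ) (enc x') = loopEnv S b a x' t := by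
  funext j
  unfold loopEnv
  by_cases h : b + width G α ≤ j ∧ j < b + width G α + width G σ
  · rw [wr_of_mem h.1 h.2, wr_of_mem (by omega) (by simp only [width_prod, width_list]; omega),
      enc_prod_left _ (by rw [width_prod]; omega),
      show j - b = width G α + (j - (b + width G α)) by omega, enc_prod_right]
  · rw [show wr _ (b + width G α) (width G σ) _ j = _ from if_neg h]
    unfold wr
    split_ifs with h'
    · simp only [width_prod, width_list] at h'
      rcases lt_or_ge j (b + width G α) with h₁ | h₁
      · rw [enc_prod_left _ (by rw [width_prod]; omega), enc_prod_left _ (by omega),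
          enc_prod_left _ (by rw [width_prod]; omega), enc_prod_left _ (by omega)]
      · rw [show j - b = width G (α × σ) + 0 by rw [width_prod]; omega, enc_prod_right,
          enc_prod_right]
    · rfl

theorem wr_wr (S : Env G) (o w : ℕ) (e e' : ℕ → List G) :
    wr (wr S o w e) o w e' = wr S o w e' := by
  funext j
  unfold wr
  split_ifs <;> rfl

theorem wr_congr {S : Env G} {o w : ℕ} {e e' : ℕ → List G} (h : ∀ j < w, e j = e' j) :
    wr S o w e = wr S o w e' := by
  funext j
  unfold wr
  split_ifs with hj
  · exact h _ (by omega)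
  · rfl

/-- A polynomial-time step does not by itself give a polynomial-time loop, since a step that doubles
its state can be iterated linearly often. Hence `hb`, which bounds the states that actually occur,
namely those after a prefix of the list. -/
theorem Comp.foldl [Finite C] {l : α → List C} {s : α → σ} {h : α → σ → C → σ}
    (hl : Comp G l) (hs : Comp G s) (hh : ∀ c, Comp G fun p : α × σ => h p.1 p.2 c)
    (hb : ∃ q : Polynomial ℕ, ∀ a t, t <+: l a →
      size G (t.foldl (h a) (s a)) ≤ q.eval (size G a)) :
    Comp G fun a => (l a).foldl (h a) (s a) := by
  obtain ⟨q₀, hq₀, h₀⟩ := (Comp.id.pair hs).pair hl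
  choose qc hqc hc using hh
  obtain ⟨Q, hQ⟩ := exists_forall_eval_le qc
  obtain ⟨qb, hb⟩ := hb
  -- a bound on the size of the states, and one on the time for one pass of the loop
  set M : Polynomial ℕ := q₀ + qb with hM
  -- The `9` is `2 + 5 + 2`: clear the old state, copy the new one into its place, clear the
  -- original of the copy.
  set B : Polynomial ℕ := Q.comp (Polynomial.X + M) + Polynomial.C 9 * M +
    Polynomial.C (4 * width G σ + 4) with hB
  have hsize : ∀ a t, t <+: l a → size G (t.foldl (h a) (s a)) ≤ M.eval (size G a) := by
    intro a t ht
    have := hb a t ht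
    simp only [hM, Polynomial.eval_add]
    omega
  refine ⟨q₀ + q₀ * B + Polynomial.C 8 * M + Polynomial.C 2 * Polynomial.X +
    Polynomial.C (width G α + 3 * width G σ + 3), fun a => ?_, fun i o b hi ho hio => ?_⟩
  · have h₁ := hsize a (l a) List.prefix_rfl
    simp only [Polynomial.eval_add, Polynomial.eval_mul, Polynomial.eval_C]
    omega
  · have hw : width G ((α × σ) × List C) = width G α + width G σ + 1 := rfl
    have hw' : width G (α × σ) = width G α + width G σ := rfl
    -- Layout from `b` on: parameter, state, unread string on stack `k`, next state from `k + 1`,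
    -- then auxiliary stacks. The next state needs a block of its own, because argument and value of
    -- a computation must be disjoint.
    set k := b + width G (α × σ) with hk
    obtain ⟨p₀, hp₀⟩ := h₀ i b (k + 1 + width G σ) (by omega) (by omega) (by omega)
    choose pc hpc using fun c => hc c b (k + 1) (k + 1 + width G σ) (by omega) (by omega) (by omega)
    set body : C → Prog G := fun c => .seq (pc c) (.seq (.clearBlock (b + width G α) (width G σ))
      (.seq (.copyBlock (k + 1) (b + width G α) (k + 1 + width G σ) (width G σ))
        (.clearBlock (k + 1) (width G σ)))) with hbody
    refine ⟨.seq (.seq p₀ (.loop k fun g => (inv (C := C) g).elim .skip body))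
      (.seq (.copyBlock (b + width G α) o (k + 1 + width G σ) (width G σ))
      (.clearBlock b (width G (α × σ)))), fun S a hS hSo hSb => ?_⟩
    set n := size G a with hn
    have hfresh : ∀ (x : σ) (t : List C) j, k + 1 ≤ j → loopEnv S b a x t j = [] :=
      fun x t j hj => by
        unfold loopEnv
        rw [wr_of_ge (by omega), hSb j (by omega)]
    have r_body : ∀ (c : C) (x : σ) (t : List C), size G x ≤ M.eval n →
        size G (h a x c) ≤ M.eval n →
        Runs (body c) (loopEnv S b a x t) (loopEnv S b a (h a x c) t) (B.eval n) := by
      intro c x t hx hx'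
      have r₁ := hpc c (loopEnv S b a x t) (a, x) (loopEnv_param S b a x t)
        (fun j _ => hfresh x t _ (by omega)) (fun j hj => hfresh x t _ (by omega))
      simp only at r₁
      set E₁ := wr (loopEnv S b a x t) (k + 1) (width G σ) (enc (h a x c)) with hE₁
      have r₂ := runs_clearBlock (b + width G α) (width G σ) E₁
      rw [((loopEnv_state S b a x t).wr (by omega)).sum_eq] at r₂
      set E₂ := wr E₁ (b + width G α) (width G σ) fun _ => [] with hE₂
      have hE₂' : Holds E₂ (k + 1) (h a x c) := (holds_wr _ _ _).wr (by omega)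
      have r₃ := runs_copyBlock (i := k + 1) (o := b + width G α) (t := k + 1 + width G σ)
        (w := width G σ) (by omega) (by omega) (by omega) E₂ (fun j hj => wr_add hj) (by
          rw [hE₂, wr_of_ge (by omega), hE₁, wr_of_ge (by omega), hfresh _ _ _ (by omega)])
      have hE₃ : wr E₂ (b + width G α) (width G σ) (enc (h a x c)) =
          wr (loopEnv S b a (h a x c) t) (k + 1) (width G σ) (enc (h a x c)) := by
        rw [hE₂, wr_wr, hE₁, wr_comm (by omega), loopEnv_update]
      rw [hE₂'.sum_eq, wr_congr hE₂', hE₃] at r₃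
      have r₄ := runs_clearBlock (k + 1) (width G σ)
        (wr (loopEnv S b a (h a x c) t) (k + 1) (width G σ) (enc (h a x c)))
      rw [(holds_wr _ _ _).sum_eq] at r₄
      refine (r₁.seq (r₂.seq (r₃.seq r₄))).of_eq ?_ ?_
      · rw [wr_wr]
        funext j
        unfold wr
        split_ifs with hj
        · rw [hfresh _ _ _ hj.1]
        · rfl
      · have h₁ := hQ c (size G (a, x))
        have h₂ : size G (a, x) ≤ n + M.eval n := by rw [size_prod]; omega
        have h₃ := eval_mono Q h₂
        simp only [hB, Polynomial.eval_add, Polynomial.eval_mul, Polynomial.eval_C,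
          Polynomial.eval_comp, Polynomial.eval_X]
        omega
    -- Loop invariant: `t` has been consumed, `t'` is still on the stack, and the state is the fold
    -- over `t`.
    have r_loop : ∀ t' t : List C, t ++ t' = l a →
        Runs (.loop k fun g => (inv (C := C) g).elim .skip body)
          (loopEnv S b a (t.foldl (h a) (s a)) t')
          (loopEnv S b a ((l a).foldl (h a) (s a)) ([] : List C))
          (t'.length * (B.eval n + 1) + 1) := by
      intro t'
      induction t' with
      | nil =>
        intro t ht
        rw [List.append_nil] at ht
        rw [ht]
        exact (Runs.loop_nil (wr_pair_list_apply ..)).mono (by omega)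
      | cons c t' ih =>
        intro t ht
        have ht' : t ++ [c] ++ t' = l a := by simpa using ht
        refine (Runs.loop_cons (g := emb c) (l := t'.map emb) (wr_pair_list_apply ..)
          (T := B.eval n) (S' := loopEnv S b a ((t ++ [c]).foldl (h a) (s a)) t') ?_
          (ih _ ht')).mono ?_
        · rw [loopEnv, wr_pair_list, inv_emb, List.foldl_append]
          refine r_body c _ t' (hsize a t ⟨_, ht⟩) ?_
          have := hsize a (t ++ [c]) ⟨_, ht'⟩
          rwa [List.foldl_append] at this
        · rw [List.length_cons, Nat.add_mul]
          omega
    have r₀ : Runs p₀ S _ (q₀.eval n) :=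
      hp₀ S a hS (fun j _ => hSb _ (by omega)) (fun j hj => hSb j (by omega))
    have r₁ := r_loop (l a) [] rfl
    have hM' : _ ≤ M.eval n := hsize a (l a) List.prefix_rfl
    set x := (l a).foldl (h a) (s a) with hx
    have r₂ := runs_copyBlock (i := b + width G α) (o := o) (t := k + 1 + width G σ)
      (w := width G σ) (by omega) (by omega) (by omega) (loopEnv S b a x ([] : List C))
      (fun j hj => by rw [loopEnv, wr_of_lt (by omega), hSo j hj]) (hfresh _ _ _ (by omega))
    rw [(loopEnv_state S b a x []).sum_eq, wr_congr (loopEnv_state S b a x [])] at r₂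
    have r₃ := runs_clearBlock b (width G (α × σ))
      (wr (loopEnv S b a x ([] : List C)) o (width G σ) (enc x))
    rw [((loopEnv_param S b a x []).wr (by omega)).sum_eq, size_prod] at r₃
    refine ((r₀.seq r₁).seq (r₂.seq r₃)).of_eq ?_ ?_
    · rw [wr_comm (by omega)]
      congr 1
      funext j
      by_cases hj : j = k
      · subst hj
        rw [wr_of_ge le_rfl, hSb _ (by omega)]
        exact wr_pair_list_apply ..
      · unfold loopEnv wr
        split_ifs <;> first | rfl | omega | skip
        exact (hSb j (by omega)).symm
    · have h₁ := hq₀ a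
      simp only [size_prod, size_list, ← hn] at h₁
      have h₂ : (l a).length * (B.eval n + 1) ≤ q₀.eval n * B.eval n + (l a).length := by
        rw [Nat.mul_add, Nat.mul_one]
        gcongr
        omega
      have h₃ : q₀.eval n ≤ M.eval n := by
        simp [hM]
      simp only [Polynomial.eval_add, Polynomial.eval_mul, Polynomial.eval_C, Polynomial.eval_X]
      omega

/-- If the state grows per step by an amount that depends on the parameter only, the total growth is
at most the length of the list times this amount. -/
theorem Comp.foldl_of_le [Finite C] {l : α → List C} {s : α → σ} {h : α → σ → C → σ}
    (hl : Comp G l) (hs : Comp G s) (hh : ∀ c, Comp G fun p : α × σ => h p.1 p.2 c)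
    (hb : ∃ q : Polynomial ℕ, ∀ a s c, size G (h a s c) ≤ size G s + q.eval (size G a)) :
    Comp G fun a => (l a).foldl (h a) (s a) := by
  refine Comp.foldl hl hs hh ?_
  obtain ⟨ql, hql, -⟩ := hl
  obtain ⟨qs, hqs, -⟩ := hs
  obtain ⟨q, hq⟩ := hb
  refine ⟨qs + ql * q, fun a t ht => ?_⟩
  have key : ∀ (t : List C) (x : σ),
      size G (t.foldl (h a) x) ≤ size G x + t.length * q.eval (size G a) := by
    intro t
    induction t with
    | nil => intro x; simp
    | cons c t ih =>
      intro x
      have h₁ := ih (h a x c)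
      have h₂ := hq a x c
      rw [List.foldl_cons, List.length_cons, Nat.add_mul]
      omega
  have h₁ := key t (s a)
  have h₂ := hqs a
  have h₃ := hql a
  rw [size_list] at h₃
  have h₄ := ht.length_le.trans h₃
  simp only [Polynomial.eval_add, Polynomial.eval_mul]
  exact h₁.trans (by gcongr)

end TAssembly

namespace TAssembly

open Function StackRep Emb

variable {G : Type}

/-! ### A library of functions on strings -/

/-- The machine pops its input onto stack `0` and thereby reverses it, so the test sees the reversed
string. Stack `0` is cleared to reach the halting configuration. -/
theorem polyTimeDecidable_of_comp {β C : Type} [Inhabited G] [Finite G] [Emb G C] [Finite C]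
    {V : List C → Bool} (hV : Comp G V) {enc : β → List C} {P : β → Prop}
    (hP : ∀ a, V (enc a).reverse = true ↔ P a) :
    PolyTimeDecidable enc P := by
  obtain ⟨q, -, h⟩ := hV
  obtain ⟨p, hp⟩ := h 0 1 2 (by simp [width_list]) (by simp [width_bool]) (by simp [width_list])
  refine polyTimeDecidable_of_run enc P (default : G) emb (.seq p (.clear 0))
    (q + Polynomial.C 2 * Polynomial.X + Polynomial.C 1) (fun l => V l.reverse) (fun l => ?_) hP
  have h₁ := hp (update (fun _ => []) 0 (l.map emb).reverse) l.reverse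
    (fun j hj => by
      obtain rfl : j = 0 := by rw [width_list] at hj; omega
      simp [enc_list])
    (fun j _ => by simp) (fun j hj => by simp [show j ≠ 0 by omega])
  refine (h₁.seq (runs_clear 0 _)).of_eq ?_ ?_
  · rw [width_bool, wr_one]
    funext j
    by_cases hj : j = 0
    · subst hj; simp
    · by_cases hj' : j = 1 <;> simp [hj, hj', StackRep.enc]
  · rw [wr_of_lt (by omega)]
    simp
    omega

variable {α β σ C D : Type} [StackRep G α] [StackRep G β] [StackRep G σ] [Emb G C] [Emb G D]

theorem Comp.const_list (l : List C) : Comp G fun _ : α => l := by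
  induction l with
  | nil => exact .nil
  | cons c l ih => exact ih.cons_const c

theorem Comp.of_eq {f g : α → β} (hf : Comp G f) (h : ∀ a, f a = g a) : Comp G g :=
  funext h ▸ hf

theorem Comp.reverse [Finite C] {l : α → List C} (hl : Comp G l) :
    Comp G fun a => (l a).reverse := by
  refine (Comp.foldl_of_le (s := fun _ => []) (h := fun _ t c => c :: t) hl .nil
    (fun c => Comp.snd'.cons_const c) ⟨1, fun a t c => by simp⟩).of_eq fun a => ?_
  simp

/-- A right fold is a left fold over the reversed list. It suits functions that build lists, since a
stack grows at its front. -/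
theorem Comp.foldr_of_le [Finite C] {l : α → List C} {s : α → σ} {h : α → C → σ → σ}
    (hl : Comp G l) (hs : Comp G s) (hh : ∀ c, Comp G fun p : α × σ => h p.1 c p.2)
    (hb : ∃ q : Polynomial ℕ, ∀ a s c, size G (h a c s) ≤ size G s + q.eval (size G a)) :
    Comp G fun a => (l a).foldr (h a) (s a) := by
  refine (Comp.foldl_of_le (h := fun a s c => h a c s) hl.reverse hs hh hb).of_eq fun a => ?_
  rw [List.foldl_reverse]

theorem Comp.append [Finite C] {f g : α → List C} (hf : Comp G f) (hg : Comp G g) :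
    Comp G fun a => f a ++ g a := by
  refine (Comp.foldr_of_le (h := fun _ c t => c :: t) hf hg
    (fun c => Comp.snd'.cons_const c) ⟨1, fun a t c => by simp⟩).of_eq fun a => ?_
  simp

theorem Comp.flatMap [Finite C] [Finite D] {l : α → List C} {F : α → C → List D} (hl : Comp G l)
    (hF : ∀ c, Comp G fun a => F a c) : Comp G fun a => (l a).flatMap (F a) := by
  refine (Comp.foldr_of_le (h := fun a c t => F a c ++ t) hl (.const_list [])
    (fun c => ((hF c).comp .fst').append .snd') ?_).of_eq fun a => ?_
  · choose q hq _ using hF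
    obtain ⟨Q, hQ⟩ := exists_forall_eval_le q
    refine ⟨Q, fun a t c => ?_⟩
    have h₁ := (hq c a).trans (hQ c _)
    simp only [size_list] at h₁
    simp only [size_list, List.length_append]
    omega
  · induction l a with
    | nil => rfl
    | cons c t ih => rw [List.foldr_cons, ih, List.flatMap_cons]

theorem Comp.map [Finite C] [Finite D] (f : C → D) {l : α → List C} (hl : Comp G l) :
    Comp G fun a => (l a).map f :=
  (hl.flatMap (F := fun _ c => [f c]) fun c => .const_list [f c]).of_eq fun a => by
    rw [List.map_eq_flatMap]

theorem Comp.filterMap [Finite C] [Finite D] (f : C → Option D) {l : α → List C}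
    (hl : Comp G l) : Comp G fun a => (l a).filterMap f :=
  (hl.flatMap (F := fun _ c => (f c).toList) fun c => .const_list _).of_eq fun a => by
    rw [List.filterMap_eq_flatMap_toList]

theorem Comp.tail [Finite C] {l : α → List C} (hl : Comp G l) : Comp G fun a => (l a).tail :=
  (hl.listCase (h := fun _ _ t => t) .nil fun _ => .snd').of_eq fun a => by
    cases l a <;> rfl

theorem Comp.takeWhile [Finite C] (p : C → Bool) {l : α → List C} (hl : Comp G l) :
    Comp G fun a => (l a).takeWhile p := by
  refine (Comp.foldr_of_le (h := fun _ c t => if p c then c :: t else []) hl (.const_list [])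
    (fun c => ?_) ⟨1, fun a t c => ?_⟩).of_eq fun a => ?_
  · cases p c
    · exact .nil
    · exact Comp.snd'.cons_const c
  · simp only [size_list, Polynomial.eval_one]
    split_ifs <;> simp
  · induction l a with
    | nil => rfl
    | cons c t ih =>
      rw [List.foldr_cons, ih, List.takeWhile_cons]

/-! ### Truth values and tests on strings -/

section

variable [Inhabited G]

theorem Comp.const_bool (b : Bool) : Comp G fun _ : α => b := by
  cases b
  · exact .const_false
  · exact .const_true

theorem Comp.and {f g : α → Bool} (hf : Comp G f) (hg : Comp G g) : Comp G fun a => f a && g a := by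
  convert hf.ite hg .const_false using 2 with a
  cases f a <;> simp

theorem Comp.or {f g : α → Bool} (hf : Comp G f) (hg : Comp G g) : Comp G fun a => f a || g a := by
  convert hf.ite .const_true hg using 2 with a
  cases f a <;> simp

theorem Comp.not {f : α → Bool} (hf : Comp G f) : Comp G fun a => !f a := by
  convert hf.ite .const_false .const_true using 2 with a
  cases f a <;> simp

theorem Comp.decide_eq_nil [Finite C] {l : α → List C} (hl : Comp G l) :
    Comp G fun a => (l a).isEmpty :=
  (hl.listCase (h := fun _ _ _ => false) .const_true fun _ => .const_false).of_eq fun a => by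
    cases l a <;> rfl

theorem Comp.any [Finite C] {l : α → List C} {P : α → C → Bool} (hl : Comp G l)
    (hP : ∀ c, Comp G fun a => P a c) : Comp G fun a => (l a).any (P a) := by
  refine (Comp.foldr_of_le (h := fun a c b => P a c || b) hl .const_false
    (fun c => ((hP c).comp .fst').or .snd') ⟨1, fun a b c => ?_⟩).of_eq fun a => ?_
  · have := size_bool_le (G := G) (P a c || b)
    simp only [Polynomial.eval_one]
    omega
  · induction l a with
    | nil => rfl
    | cons c t ih => rw [List.foldr_cons, ih, List.any_cons]

theorem Comp.all [Finite C] {l : α → List C} {P : α → C → Bool} (hl : Comp G l)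
    (hP : ∀ c, Comp G fun a => P a c) : Comp G fun a => (l a).all (P a) :=
  (hl.any fun c => (hP c).not).not.of_eq fun a => by
    induction l a with
    | nil => rfl
    | cons c t ih => rw [List.any_cons, List.all_cons, ← ih]; simp

/-- The state of a loop that drops symbols: whether a symbol was kept, and the symbols that are
kept, in reverse. -/
def dropStep (p : C → Bool) (s : Bool × List C) (c : C) : Bool × List C :=
  if s.1 || !p c then (true, c :: s.2) else s

theorem Comp.dropWhile [Finite C] (p : C → Bool) {l : α → List C} (hl : Comp G l) :
    Comp G fun a => (l a).dropWhile p := by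
  have h : Comp G fun a => (l a).foldl (dropStep p) (false, []) := by
    refine Comp.foldl_of_le (h := fun _ => dropStep p) hl (Comp.const_false.pair .nil) (fun c => ?_)
      ⟨Polynomial.C 2, fun a s c => ?_⟩
    · exact (Comp.snd'.fst.or (.const_bool _)).ite
        (Comp.const_true.pair (Comp.snd'.snd.cons_const c)) .snd'
    · have := size_bool_le (G := G) true
      obtain ⟨b, t⟩ := s
      simp only [Polynomial.eval_C, dropStep]
      split_ifs
      · simp only [size_prod, size_list, List.length_cons]
        omega
      · omega
  refine h.snd.reverse.of_eq fun a => ?_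
  have h₁ : ∀ l t : List C, l.foldl (dropStep p) (true, t) = (true, l.reverse ++ t) := by
    intro l
    induction l with
    | nil => intro t; rfl
    | cons c l ih => intro t; simp [dropStep, ih]
  induction l a with
  | nil => rfl
  | cons c l ih =>
    rw [List.foldl_cons, List.dropWhile_cons]
    cases hc : p c
    · simp [dropStep, hc, h₁]
    · simpa [dropStep, hc] using ih

/-- The state of a loop that compares strings: what is left of the second string, and whether its
symbols so far were those of the first string. -/
def eqStep [DecidableEq C] (s : List C × Bool) (c : C) : List C × Bool :=
  match s.1 with
  | [] => ([], false)
  | d :: t => (t, s.2 && decide (c = d))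

theorem Comp.decide_eq [Finite C] [DecidableEq C] {f g : α → List C} (hf : Comp G f)
    (hg : Comp G g) : Comp G fun a => decide (f a = g a) := by
  have h : Comp G fun a => (f a).foldl eqStep (g a, true) := by
    refine Comp.foldl_of_le (h := fun _ => eqStep) hf (hg.pair .const_true) (fun c => ?_)
      ⟨Polynomial.C 1, fun a s c => ?_⟩
    · exact Comp.listCase (l := fun p : α × List C × Bool => p.2.1)
        (h := fun p d t => (t, p.2.2 && decide (c = d))) Comp.snd'.fst
        (Comp.nil.pair .const_false)
        fun d => Comp.snd'.pair (Comp.fst'.snd.snd.and (.const_bool _))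
    · obtain ⟨t, b⟩ := s
      simp only [Polynomial.eval_C, eqStep]
      cases t with
      | nil =>
        have := size_bool_le (G := G) false
        simp only [size_prod, size_list, List.length_nil]
        omega
      | cons d t =>
        have := size_bool_le (G := G) (b && decide (c = d))
        simp only [size_prod, size_list, List.length_cons]
        omega
  refine (h.snd.and h.fst.decide_eq_nil).of_eq fun a => ?_
  have h₀ : ∀ l t : List C, (l.foldl eqStep (t, false)).2 = false := by
    intro l
    induction l with
    | nil => intro t; rfl
    | cons c l ih => intro t; cases t <;> simp [eqStep, ih]
  generalize g a = t
  induction f a generalizing t with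
  | nil => cases t <;> simp
  | cons c l ih =>
    cases t with
    | nil => simp [eqStep, h₀]
    | cons d t =>
      by_cases hcd : c = d
      · simpa [eqStep, hcd] using ih t
      · simp [eqStep, hcd, h₀]

end

/-! ### Lists of strings -/

section

variable {E : Type}

/-- The strings of a list, each followed by a separator. -/
def flat (ls : List (List E)) : List (Option E) := ls.flatMap fun l => l.map some ++ [none]

theorem flat_cons (l : List E) (ls : List (List E)) :
    flat (l :: ls) = l.map some ++ none :: flat ls := by
  simp [flat]

variable [Emb G (Option E)]

instance : StackRep G (List (List E)) where
  width := 1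
  enc ls _ := (flat ls).map emb

theorem size_lists (ls : List (List E)) : size G ls = (flat ls).length := by
  simp [size, StackRep.enc, width]

theorem size_cons_lists (l : List E) (ls : List (List E)) :
    size G (l :: ls) = l.length + 1 + size G ls := by
  simp only [size_lists, flat_cons, List.length_append, List.length_map, List.length_cons]
  omega

theorem Comp.flat {f : α → List (List E)} (hf : Comp G f) : Comp G fun a => flat (f a) :=
  (Comp.of_copy (f := fun ls : List (List E) => TAssembly.flat ls) 0 le_rfl
    fun _ _ _ => rfl).comp hf

/-- A list of strings has, by definition, the same stack contents as its flattening, so the very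
same programs work. -/
theorem Comp.of_flat {f : α → List (List E)} (hf : Comp G fun a => TAssembly.flat (f a)) :
    Comp G f := by
  obtain ⟨q, hq, h⟩ := hf
  refine ⟨q, fun a => ?_, h⟩
  rw [size_lists, ← size_list (G := G)]
  exact hq a

theorem Comp.nil_lists : Comp G fun _ : α => ([] : List (List E)) :=
  .of_flat (.const_list [])

theorem Comp.cons_lists [Emb G E] [Finite E] {f : α → List E} {g : α → List (List E)}
    (hf : Comp G f) (hg : Comp G g) : Comp G fun a => f a :: g a :=
  .of_flat <| ((hf.map some).append (hg.flat.cons_const none)).of_eq fun a => by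
    rw [flat_cons]

/-- The state of a loop over a list of strings: the symbols of the current string, in reverse, and
the state proper. -/
def flatStep (h : σ → List E → σ) (s : List E × σ) : Option E → List E × σ
  | some c => (c :: s.1, s.2)
  | none => ([], h s.2 s.1.reverse)

theorem foldl_flatStep (h : σ → List E → σ) (ls : List (List E)) (x : σ) :
    (flat ls).foldl (flatStep h) ([], x) = ([], ls.foldl h x) := by
  have h₁ : ∀ (l : List E) (t : List E) (x : σ),
      (l.map some).foldl (flatStep h) (t, x) = (l.reverse ++ t, x) := by
    intro l
    induction l with
    | nil => intro t x; rfl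
    | cons c l ih => intro t x; simp [flatStep, ih]
  induction ls generalizing x with
  | nil => rfl
  | cons l ls ih => simp [flat_cons, h₁, flatStep, ih]

/-- A loop over symbols simulates the loop over strings: letters are collected in a buffer, and a
separator hands the buffer to `h`. The growth in one step may depend on the current string, which is
part of the list and hence short. -/
theorem Comp.foldl_lists [Emb G E] [Finite E] {l : α → List (List E)} {s : α → σ}
    {h : α → σ → List E → σ} (hl : Comp G l) (hs : Comp G s)
    (hh : Comp G fun p : (α × σ) × List E => h p.1.1 p.1.2 p.2)
    (hb : ∃ q : Polynomial ℕ, ∀ a s w, size G (h a s w) ≤ size G s + q.eval (size G a + w.length)) :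
    Comp G fun a => (l a).foldl (h a) (s a) := by
  have key : Comp G fun a => (TAssembly.flat (l a)).foldl (flatStep (h a)) ([], s a) := by
    refine Comp.foldl (h := fun a => flatStep (h a)) hl.flat (Comp.nil.pair hs) (fun c => ?_) ?_
    · cases c with
      | none =>
        exact Comp.nil.pair (hh.comp ((Comp.fst'.pair Comp.snd'.snd).pair Comp.snd'.fst.reverse))
      | some c => exact (Comp.snd'.fst.cons_const c).pair Comp.snd'.snd
    · obtain ⟨q, hq⟩ := hb
      obtain ⟨ql, hql, -⟩ := hl
      obtain ⟨qs, hqs, -⟩ := hs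
      -- `N` bounds the buffer together with the unread symbols, and therefore every string that is
      -- handed to `h`.
      have bound : ∀ (a : α) (N : ℕ) (t : List (Option E)) (w : List E) (x : σ),
          w.length + t.length ≤ N →
          size G (t.foldl (flatStep (h a)) (w, x)) ≤
            N + size G x + t.length * q.eval (size G a + N) := by
        intro a N t
        induction t with
        | nil => intro w x hN; simp [size_prod] at hN ⊢; omega
        | cons c t ih =>
          intro w x hN
          rw [List.length_cons] at hN
          rw [List.foldl_cons, List.length_cons, Nat.add_mul]
          cases c with
          | none =>
            have h₁ := ih [] (h a x w.reverse) (by simp; omega)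
            have h₂ := hq a x w.reverse
            have h₃ := eval_mono q (show size G a + w.reverse.length ≤ size G a + N by simp; omega)
            simp only [flatStep]
            omega
          | some c =>
            have h₁ := ih (c :: w) x (by simp; omega)
            simp only [flatStep]
            omega
      refine ⟨ql + qs + ql * q.comp (Polynomial.X + ql), fun a t ht => ?_⟩
      have h₁ := hql a
      rw [size_lists] at h₁
      have h₂ := ht.length_le.trans h₁
      have h₃ := hqs a
      simp only [Polynomial.eval_add, Polynomial.eval_mul, Polynomial.eval_comp, Polynomial.eval_X]
      exact (bound a _ t [] (s a) (by simpa using h₂)).trans (by gcongr)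
  exact key.snd.of_eq fun a => by rw [foldl_flatStep]

theorem Comp.decide_mem [Inhabited G] [Emb G E] [Finite E] [DecidableEq E] {f : α → List E}
    {l : α → List (List E)} (hf : Comp G f) (hl : Comp G l) :
    Comp G fun a => decide (f a ∈ l a) := by
  refine (Comp.foldl_lists (s := fun _ => false) (h := fun a b w => b || decide (f a = w)) hl
    .const_false (Comp.fst'.snd.or ((hf.comp Comp.fst'.fst).decide_eq .snd'))
    ⟨1, fun a b w => ?_⟩).of_eq fun a => ?_
  · have := size_bool_le (G := G) (b || decide (f a = w))
    simp only [Polynomial.eval_one]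
    omega
  · have : ∀ (ls : List (List E)) (b : Bool),
        ls.foldl (fun b w => b || decide (f a = w)) b = (b || decide (f a ∈ ls)) := by
      intro ls
      induction ls with
      | nil => intro b; simp
      | cons w ls ih => intro b; simp [ih, Bool.or_assoc]
    simp [this]

end

end TAssembly

namespace TAssembly

/-! ### Matching a template against a string -/

variable {A : Type}

/-- The string `u` is obtained from `x` by replacing each wildcard by a non-empty string. -/
inductive Matches : List (Option A) → List A → Prop
  | nil : Matches [] []
  | letter {x u} (a : A) : Matches x u → Matches (x ++ [some a]) (u ++ [a])
  | wildcard {x u v} : v ≠ [] → Matches x u → Matches (x ++ [none]) (u ++ v)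

theorem Matches.append_letters {x : List (Option A)} {u : List A} (h : Matches x u) (v : List A) :
    Matches (x ++ v.map some) (u ++ v) := by
  induction v using List.reverseRecOn with
  | nil => simpa using h
  | append_singleton v a ih => simpa using ih.letter a

theorem matches_letter {x : List (Option A)} {a : A} {u : List A}
    (h : Matches (x ++ [some a]) u) : ∃ u', u = u' ++ [a] ∧ Matches x u' := by
  generalize hx : x ++ [some a] = y at h
  cases h with
  | nil => simp at hx
  | letter b h =>
    obtain ⟨rfl, h'⟩ := List.append_inj' hx rfl
    obtain rfl : a = b := by simpa using h'
    exact ⟨_, rfl, h⟩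
  | wildcard _ _ =>
    have := (List.append_inj' hx rfl).2
    simp at this

theorem matches_wildcard {x : List (Option A)} {u : List A} (h : Matches (x ++ [none]) u) :
    ∃ u' v, u = u' ++ v ∧ v ≠ [] ∧ Matches x u' := by
  generalize hx : x ++ [none] = y at h
  cases h with
  | nil => simp at hx
  | letter b h =>
    have := (List.append_inj' hx rfl).2
    simp at this
  | wildcard hv h =>
    obtain ⟨rfl, -⟩ := List.append_inj' hx rfl
    exact ⟨_, _, rfl, hv, h⟩

theorem matches_of_blocks (B : List (List A × Bool)) (hB : ∀ b ∈ B, b.1 ≠ []) :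
    Matches (B.map fun b => if b.2 then [none] else b.1.map some).flatten
      (B.map Prod.fst).flatten := by
  induction B using List.reverseRecOn with
  | nil => exact .nil
  | append_singleton B b ih =>
    have h := ih fun b' hb' => hB b' (by simp [hb'])
    simp only [List.map_append, List.flatten_append, List.map_cons, List.map_nil,
      List.flatten_cons, List.flatten_nil, List.append_nil]
    split_ifs
    · exact h.wildcard (hB b (by simp))
    · exact h.append_letters b.1

/-- Blocks that are kept can be refined to single letters without changing the template, so
`Matches` may forget the block boundaries. -/
theorem Matches.exists_blocks {x : List (Option A)} {u : List A} (h : Matches x u) :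
    ∃ B : List (List A × Bool), (∀ b ∈ B, b.1 ≠ []) ∧ (B.map Prod.fst).flatten = u ∧
      x = (B.map fun b => if b.2 then [none] else b.1.map some).flatten := by
  induction h with
  | nil => exact ⟨[], by simp⟩
  | letter a _ ih =>
    obtain ⟨B, h₁, rfl, rfl⟩ := ih
    refine ⟨B ++ [([a], false)], ?_, by simp, by simp⟩
    intro b hb
    rcases List.mem_append.1 hb with hb | hb
    · exact h₁ b hb
    · rw [List.mem_singleton.1 hb]; simp
  | @wildcard _ _ v hv _ ih =>
    obtain ⟨B, h₁, rfl, rfl⟩ := ih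
    refine ⟨B ++ [(v, true)], ?_, by simp, by simp⟩
    intro b hb
    rcases List.mem_append.1 hb with hb | hb
    · exact h₁ b hb
    · rw [List.mem_singleton.1 hb]; exact hv

theorem matches_map_some (u : List A) : Matches (u.map some) u := by
  simpa using Matches.nil.append_letters u

theorem Matches.eq_map_some {x : List (Option A)} {u : List A} (h : Matches x u)
    (hx : none ∉ x) : x = u.map some := by
  induction h with
  | nil => rfl
  | letter a _ ih =>
    rw [ih fun h => hx (by simp [h])]
    simp
  | wildcard => simp at hx

/-- Blocks are non-empty, so "not none" and "not all" replaced can be read off from the template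
itself: a wildcard and a letter occur in it. -/
theorem mem_templates_iff {w : List A} {x : List (Option A)} :
    x ∈ Templates w ↔ none ∈ x ∧ (∃ a, some a ∈ x) ∧ ∃ u, u <:+: w ∧ Matches x u := by
  constructor
  · rintro ⟨B, hB, hw, ⟨b, hb, hb₁⟩, ⟨c, hc, hc₁⟩, rfl⟩
    refine ⟨?_, ?_, _, hw, matches_of_blocks B hB⟩
    · exact List.mem_flatten.2 ⟨_, List.mem_map_of_mem hb, by simp [hb₁]⟩
    · obtain ⟨a, ha⟩ := List.exists_mem_of_ne_nil _ (hB c hc)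
      exact ⟨a, List.mem_flatten.2 ⟨_, List.mem_map_of_mem hc, by simp [hc₁, ha]⟩⟩
  · rintro ⟨hn, ⟨a, ha⟩, u, hu, h⟩
    obtain ⟨B, hB, rfl, rfl⟩ := h.exists_blocks
    refine ⟨B, hB, hu, ?_, ?_, rfl⟩
    · obtain ⟨l, hl, hl'⟩ := List.mem_flatten.1 hn
      obtain ⟨b, hb, rfl⟩ := List.mem_map.1 hl
      refine ⟨b, hb, ?_⟩
      by_contra hb'
      simp [hb'] at hl'
    · obtain ⟨l, hl, hl'⟩ := List.mem_flatten.1 ha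
      obtain ⟨b, hb, rfl⟩ := List.mem_map.1 hl
      refine ⟨b, hb, ?_⟩
      by_contra hb'
      rw [Bool.not_eq_false] at hb'
      simp [hb'] at hl'

/-- Without wildcards a match is an equality, so substrings and templates fall under one criterion.
-/
theorem mem_objects_iff {w : List A} {x : List (Option A)} :
    x ∈ Objects w ↔ (∃ a, some a ∈ x) ∧ ∃ u, u <:+: w ∧ Matches x u := by
  constructor
  · rintro (⟨u, hu, hw, rfl⟩ | h)
    · obtain ⟨a, ha⟩ := List.exists_mem_of_ne_nil _ hu
      exact ⟨⟨a, by simp [ha]⟩, u, hw, matches_map_some u⟩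
    · exact (mem_templates_iff.1 h).2
  · rintro ⟨⟨a, ha⟩, u, hu, h⟩
    by_cases hn : none ∈ x
    · exact Or.inr (mem_templates_iff.2 ⟨hn, ⟨a, ha⟩, u, hu, h⟩)
    · have hx := h.eq_map_some hn
      refine Or.inl ⟨u, ?_, hu, hx⟩
      rintro rfl
      rw [hx] at ha
      simp at ha

/-- The cells for the letters of `r`, where `f` gives the marks of the prefixes, after `p`. -/
def cells (f : List A → Bool) : List A → List A → List (Option A × Bool)
  | _, [] => []
  | p, a :: r => (some a, f (p ++ [a])) :: cells f (p ++ [a]) r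

theorem any_cells (f : List A → Bool) (p r : List A) :
    (cells f p r).any (fun c => c.2) = true ↔ ∃ q, q ≠ [] ∧ q <+: r ∧ f (p ++ q) = true := by
  induction r generalizing p with
  | nil => simp [cells]
  | cons a r ih =>
    simp only [cells, List.any_cons, Bool.or_eq_true, ih]
    constructor
    · rintro (h | ⟨q, -, hq, h⟩)
      · exact ⟨[a], by simp, by simp, h⟩
      · exact ⟨a :: q, by simp, by simpa using hq, by simpa using h⟩
    · rintro ⟨q, hq, hqr, h⟩
      cases q with
      | nil => exact absurd rfl hq
      | cons b q =>
        obtain ⟨rfl, hqr'⟩ := List.cons_prefix_cons.1 hqr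
        cases q with
        | nil => exact Or.inl h
        | cons d q => exact Or.inr ⟨d :: q, by simp, hqr', by simpa using h⟩

open Classical in
/-- A suffix of `p` is matched by `x`. -/
noncomputable def mark (x : List (Option A)) (p : List A) : Bool :=
  decide (∃ v, v <:+ p ∧ Matches x v)

theorem mark_nil_right (x : List (Option A)) (c : Option A) : mark (x ++ [c]) [] = false := by
  simp only [mark, decide_eq_false_iff_not, List.suffix_nil]
  rintro ⟨v, rfl, h⟩
  cases c with
  | none =>
    obtain ⟨u, v, huv, hv, -⟩ := matches_wildcard h
    simp_all
  | some a =>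
    obtain ⟨u, hu, -⟩ := matches_letter h
    simp at hu

open Classical in
-- A wildcard absorbs at least one letter, so it always absorbs the last letter `b`; what precedes
-- it can end at any prefix of `p`, including `p` itself.
theorem mark_wildcard (x : List (Option A)) (p : List A) (b : A) :
    mark (x ++ [none]) (p ++ [b]) = decide (∃ q, q <+: p ∧ mark x q = true) := by
  rw [Bool.eq_iff_iff]
  simp only [mark, decide_eq_true_eq]
  constructor
  · rintro ⟨v, ⟨t, ht⟩, h⟩
    obtain ⟨u, v', rfl, hv, h'⟩ := matches_wildcard h
    obtain ⟨v'', c, rfl⟩ := List.eq_nil_or_concat v' |>.resolve_left hv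
    have ht' : (t ++ u ++ v'') ++ [c] = p ++ [b] := by simpa using ht
    obtain ⟨rfl, -⟩ := List.append_inj' ht' rfl
    exact ⟨t ++ u, ⟨v'', rfl⟩, u, ⟨t, rfl⟩, h'⟩
  · rintro ⟨q, ⟨r, rfl⟩, v, ⟨t, rfl⟩, h⟩
    exact ⟨v ++ (r ++ [b]), ⟨t, by simp⟩, h.wildcard (by simp)⟩

/-! ### Deciding matches by a sweep over the marked prefixes -/

section

variable [DecidableEq A]

/-- One symbol `c` of a template is matched against a string whose prefixes are marked: the first
cell stands for the empty prefix, any other cell for the prefix that ends with its letter. The mark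
of a prefix says that a suffix of it is matched by the symbols so far. -/
def sweep (c : Option A) : Bool → List (Option A × Bool) → List (Option A × Bool)
  | _, [] => []
  | carry, (a, m) :: R =>
    (a, carry && (c.isNone || decide (a = c))) :: sweep c (if c.isNone then carry || m else m) R

/-- Some substring of `w` is matched by `x`. -/
def matchTest (w : List A) (x : List (Option A)) : Bool :=
  (x.foldl (fun R c => sweep c false R) ((none, true) :: w.map fun a => (some a, true))).any
    fun c => c.2

/-- The test for being an object. -/
def objectTest (w : List A) (x : List (Option A)) : Bool :=
  x.any (fun c => c.isSome) && matchTest w x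

/-- The carry is the mark of the previous prefix: a letter extends a match by exactly one position.
-/
theorem sweep_letter {a : A} {f f' : List A → Bool}
    (hf : ∀ p b, f' (p ++ [b]) = (f p && decide (b = a))) (p r : List A) :
    sweep (some a) (f p) (cells f p r) = cells f' p r := by
  induction r generalizing p with
  | nil => rfl
  | cons b r ih => simp [cells, sweep, hf, ih]

/-- The carry `F` is the disjunction of all marks seen so far. A cell receives it before its own
mark is added, which makes the wildcard absorb at least one letter. -/
theorem sweep_wildcard {f f' F : List A → Bool} (hF : ∀ p b, F (p ++ [b]) = (F p || f (p ++ [b])))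
    (hf : ∀ p b, f' (p ++ [b]) = F p) (p r : List A) :
    sweep none (F p) (cells f p r) = cells f' p r := by
  induction r generalizing p with
  | nil => rfl
  | cons b r ih => simp [cells, sweep, hf, ← ih, hF]

theorem mark_letter (x : List (Option A)) (a : A) (p : List A) (b : A) :
    mark (x ++ [some a]) (p ++ [b]) = (mark x p && decide (b = a)) := by
  rw [Bool.eq_iff_iff]
  simp only [mark, Bool.and_eq_true, decide_eq_true_eq]
  constructor
  · rintro ⟨v, hv, h⟩
    obtain ⟨v', rfl, h'⟩ := matches_letter h
    obtain ⟨t, ht⟩ := hv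
    rw [← List.append_assoc] at ht
    obtain ⟨rfl, hb⟩ := List.append_inj' ht rfl
    exact ⟨⟨v', ⟨t, rfl⟩, h'⟩, by simpa using hb.symm⟩
  · rintro ⟨⟨v, ⟨t, rfl⟩, h⟩, rfl⟩
    exact ⟨v ++ [b], ⟨t, by simp⟩, h.letter b⟩

/-- Invariant of the dynamic programming, by induction on the template from the right. Initially all
marks are set, since the empty template matches the empty suffix of every prefix. -/
theorem foldl_sweep (w : List A) (x : List (Option A)) :
    x.foldl (fun R c => sweep c false R) ((none, true) :: w.map fun a => (some a, true)) =
      (none, mark x []) :: cells (mark x) [] w := by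
  classical
  induction x using List.reverseRecOn with
  | nil =>
    have h₀ : ∀ p : List A, mark [] p = true := fun p => by
      simp only [mark, decide_eq_true_eq]
      exact ⟨[], List.nil_suffix, .nil⟩
    have h₁ : ∀ p r : List A, cells (mark []) p r = r.map fun a => (some a, true) := by
      intro p r
      induction r generalizing p with
      | nil => rfl
      | cons a r ih => simp [cells, h₀, ih]
    simp [h₀, h₁]
  | append_singleton x c ih =>
    rw [List.foldl_append, ih, mark_nil_right]
    cases c with
    | some a =>
      simp only [List.foldl_cons, List.foldl_nil, sweep, Bool.false_and, Option.isNone_some,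
        Bool.false_eq_true, if_false]
      rw [sweep_letter (mark_letter x a)]
    | none =>
      have h₀ : mark x [] = decide (∃ q, q <+: [] ∧ mark x q = true) := by simp
      simp only [List.foldl_cons, List.foldl_nil, sweep, Bool.false_and, Option.isNone_none,
        if_true, Bool.false_or]
      rw [h₀, sweep_wildcard (F := fun p => decide (∃ q, q <+: p ∧ mark x q = true)) _
        (mark_wildcard x)]
      intro p b
      rw [Bool.eq_iff_iff]
      simp only [Bool.or_eq_true, decide_eq_true_eq]
      simp only [List.prefix_concat_iff]
      constructor
      · rintro ⟨q, rfl | hq, h⟩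
        · exact Or.inr h
        · exact Or.inl ⟨q, hq, h⟩
      · rintro (⟨q, hq, h⟩ | h)
        · exact ⟨q, Or.inr hq, h⟩
        · exact ⟨_, Or.inl rfl, h⟩

/-- A substring is a suffix of a prefix; the first cell takes care of the empty prefix. -/
theorem matchTest_iff (w : List A) (x : List (Option A)) :
    matchTest w x = true ↔ ∃ u, u <:+: w ∧ Matches x u := by
  rw [matchTest, foldl_sweep, List.any_cons, Bool.or_eq_true, any_cells]
  simp only [List.nil_append, mark, decide_eq_true_eq]
  constructor
  · rintro (⟨v, hv, h⟩ | ⟨q, -, hq, v, hv, h⟩)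
    · rw [List.suffix_nil.1 hv] at h
      exact ⟨[], List.nil_infix, h⟩
    · exact ⟨v, hv.isInfix.trans hq.isInfix, h⟩
  · rintro ⟨u, ⟨s, t, rfl⟩, h⟩
    by_cases hsu : s ++ u = []
    · obtain ⟨rfl, rfl⟩ := List.append_eq_nil_iff.1 hsu
      exact Or.inl ⟨[], List.suffix_rfl, h⟩
    · exact Or.inr ⟨s ++ u, hsu, ⟨t, rfl⟩, u, ⟨s, rfl⟩, h⟩

theorem objectTest_iff (w : List A) (x : List (Option A)) :
    objectTest w x = true ↔ x ∈ Objects w := by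
  rw [objectTest, Bool.and_eq_true, matchTest_iff, mem_objects_iff, List.any_eq_true]
  simp only [Option.isSome_iff_exists]
  refine and_congr_left fun _ => ⟨?_, ?_⟩
  · rintro ⟨_, h, a, rfl⟩
    exact ⟨a, h⟩
  · rintro ⟨a, h⟩
    exact ⟨_, h, a, rfl⟩

theorem length_sweep (c : Option A) (b : Bool) (R : List (Option A × Bool)) :
    (sweep c b R).length = R.length := by
  induction R generalizing b with
  | nil => rfl
  | cons d R ih => simp [sweep, ih]

/-! ### The test in polynomial time -/

/-- The state of a loop that computes `sweep`. -/
def sweepStep (c : Option A) (s : Bool × List (Option A × Bool)) (d : Option A × Bool) :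
    Bool × List (Option A × Bool) :=
  (if c.isNone then s.1 || d.2 else d.2, (d.1, s.1 && (c.isNone || decide (d.1 = c))) :: s.2)

theorem foldl_sweepStep (c : Option A) (R T : List (Option A × Bool)) (b : Bool) :
    (R.foldl (sweepStep c) (b, T)).2.reverse = T.reverse ++ sweep c b R := by
  induction R generalizing b T with
  | nil => simp [sweep]
  | cons d R ih => simp [sweepStep, ih, sweep]

variable {G α : Type} [Inhabited G] [StackRep G α] [Finite A] [Emb G (Option A × Bool)]

theorem Comp.sweep (c : Option A) {R : α → List (Option A × Bool)} (hR : Comp G R) :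
    Comp G fun a => sweep c false (R a) := by
  have h : Comp G fun a => (R a).foldl (sweepStep c) (false, []) := by
    refine Comp.foldl_of_le (h := fun _ => sweepStep c) hR (Comp.const_false.pair .nil)
      (fun d => ?_) ⟨Polynomial.C 2, fun a s d => ?_⟩
    · refine Comp.pair ?_ ?_
      · cases c
        · exact Comp.snd'.fst.or (.const_bool _)
        · exact .const_bool _
      · refine (Comp.ite Comp.snd'.fst
          (Comp.snd'.snd.cons_const (d.1, c.isNone || decide (d.1 = c)))
          (Comp.snd'.snd.cons_const (d.1, false))).of_eq fun p => ?_
        cases p.2.1 <;> simp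
    · obtain ⟨b, T⟩ := s
      have := size_bool_le (G := G) (if c.isNone then b || d.2 else d.2)
      simp only [sweepStep, size_prod, size_list, List.length_cons, Polynomial.eval_C]
      omega
  refine h.snd.reverse.of_eq fun a => ?_
  rw [foldl_sweepStep, List.reverse_nil, List.nil_append]

theorem Comp.objectTest [Emb G A] [Emb G (Option A)] {w : α → List A} {x : α → List (Option A)}
    (hw : Comp G w) (hx : Comp G x) : Comp G fun a => objectTest (w a) (x a) := by
  refine (hx.any (P := fun _ c => c.isSome) fun c => .const_bool _).and
    (Comp.any (C := Option A × Bool) (P := fun _ c => c.2) ?_ fun c => .const_bool _)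
  refine Comp.foldl_of_le (h := fun _ R c => TAssembly.sweep c false R) hx
    ((hw.map fun a => (some a, true)).cons_const _) (fun c => .sweep c .snd')
    ⟨0, fun a R c => ?_⟩
  simp [length_sweep]

end

end TAssembly

namespace TAssembly

/-! ### Rule applications as strings -/

section

variable {A : Type}

/-- The symbol of a certificate for a position with its bit. -/
def CertSym.ofMarked (d : Option A × Bool) : CertSym A := .sym d.1 d.2

/-- The position with its bit that a symbol of a certificate stands for. -/
def CertSym.toMarked : CertSym A → Option (Option A × Bool)
  | .sym a b => some (a, b)
  | _ => none

/-- The symbol is not a separator. -/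
def CertSym.notComma : CertSym A → Bool
  | .comma => false
  | _ => true

/-- The symbol is the tag of a rule. -/
def CertSym.isTag : CertSym A → Bool
  | .concatTag => true
  | .instTag => true
  | _ => false

instance [Finite A] : Finite (CertSym A) := by
  let f : CertSym A → (Option A × Bool) ⊕ Fin 3 := fun
    | .sym a b => .inl (a, b)
    | .concatTag => .inr 0
    | .instTag => .inr 1
    | .comma => .inr 2
  refine Finite.of_injective f fun x y h => ?_
  cases x <;> cases y <;> simp_all [f]

noncomputable instance : DecidableEq (CertSym A) := Classical.decEq _

/-- The string for a rule application with tag `t`, operands `m` and `u`, and product `z`. -/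
def ruleString (t : CertSym A) (m : List (Option A × Bool)) (u z : List (Option A)) :
    List (CertSym A) :=
  t :: m.map .ofMarked ++ .comma :: encodeObj u ++ .comma :: encodeObj z

/-- The positions of `T`, where those in `S` are marked. -/
def marked (T : List (Option A)) (S : Finset (Fin T.length)) : List (Option A × Bool) :=
  (List.finRange T.length).map fun p => (T.get p, decide (p ∈ S))

theorem map_fst_marked (T : List (Option A)) (S : Finset (Fin T.length)) :
    (marked T S).map Prod.fst = T := by
  simp [marked, Function.comp_def]

theorem instantiate_eq (T : List (Option A)) (S : Finset (Fin T.length)) (u : List (Option A)) :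
    instantiate T S u = (marked T S).flatMap fun d => if d.2 then u else [d.1] := by
  simp [instantiate, marked, List.flatMap_map]

theorem exists_marked (m : List (Option A × Bool)) :
    ∃ S : Finset (Fin (m.map Prod.fst).length), marked (m.map Prod.fst) S = m := by
  refine ⟨Finset.univ.filter fun p => (m.get (p.cast (by simp))).2 = true, ?_⟩
  refine List.ext_getElem (by simp [marked]) fun i h₁ h₂ => ?_
  ext <;> simp [marked]

theorem encode_concat (x y : List (Option A)) :
    (RuleApp.concat x y).encode = ruleString .concatTag (x.map (·, false)) y (x ++ y) := by
  simp [RuleApp.encode, ruleString, encodeObj, CertSym.ofMarked, Function.comp_def]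

theorem encode_inst (T : List (Option A)) (S : Finset (Fin T.length)) (u : List (Option A)) :
    (RuleApp.inst T S u).encode = ruleString .instTag (marked T S) u (instantiate T S u) := by
  simp [RuleApp.encode, ruleString, encodeObj, CertSym.ofMarked, marked, Function.comp_def]

/-- The first operand in the string for a rule application. -/
def firstField (c : List (CertSym A)) : List (Option A × Bool) :=
  (c.tail.takeWhile CertSym.notComma).filterMap CertSym.toMarked

/-- The second operand in the string for a rule application. -/
def secondField (c : List (CertSym A)) : List (Option A) :=
  (((c.dropWhile CertSym.notComma).tail.takeWhile CertSym.notComma).filterMap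
    CertSym.toMarked).map Prod.fst

/-- The string is that of a concatenation. -/
def isConcat : List (CertSym A) → Bool
  | .concatTag :: _ => true
  | _ => false

/-- The product of the rule application which the string describes. -/
def product (c : List (CertSym A)) : List (Option A) :=
  if isConcat c then (firstField c).map Prod.fst ++ secondField c
  else (firstField c).flatMap fun d => if d.2 then secondField c else [d.1]

/-- The string for the rule application that has the operands in the given string. -/
def reencode (c : List (CertSym A)) : List (CertSym A) :=
  if isConcat c then
    ruleString .concatTag ((firstField c).map fun d => (d.1, false)) (secondField c) (product c)
  else ruleString .instTag (firstField c) (secondField c) (product c)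

theorem takeWhile_notComma (m : List (Option A × Bool)) (l : List (CertSym A)) :
    (m.map CertSym.ofMarked ++ .comma :: l).takeWhile CertSym.notComma =
      m.map CertSym.ofMarked := by
  induction m with
  | nil => simp [CertSym.notComma]
  | cons d m ih =>
    rw [List.map_cons, List.cons_append, List.takeWhile_cons, ih]
    rfl

theorem dropWhile_notComma (m : List (Option A × Bool)) (l : List (CertSym A)) :
    (m.map CertSym.ofMarked ++ .comma :: l).dropWhile CertSym.notComma = .comma :: l := by
  induction m with
  | nil => simp [CertSym.notComma]
  | cons d m ih =>
    rw [List.map_cons, List.cons_append, List.dropWhile_cons, ih]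
    rfl

theorem filterMap_toMarked (m : List (Option A × Bool)) :
    (m.map CertSym.ofMarked).filterMap CertSym.toMarked = m := by
  rw [List.filterMap_map]
  exact List.filterMap_some

theorem encodeObj_eq (x : List (Option A)) :
    encodeObj x = (x.map (·, false)).map CertSym.ofMarked := by
  simp [encodeObj, CertSym.ofMarked, Function.comp_def]

theorem firstField_ruleString (t : CertSym A) (m : List (Option A × Bool))
    (u z : List (Option A)) : firstField (ruleString t m u z) = m := by
  simp only [firstField, ruleString, List.cons_append, List.append_assoc, List.tail_cons]
  rw [takeWhile_notComma, filterMap_toMarked]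

theorem secondField_ruleString {t : CertSym A} (ht : t.notComma = true)
    (m : List (Option A × Bool)) (u z : List (Option A)) :
    secondField (ruleString t m u z) = u := by
  simp only [secondField, ruleString, List.cons_append, List.append_assoc,
    List.dropWhile_cons, ht, if_true]
  rw [dropWhile_notComma, List.tail_cons, encodeObj_eq, takeWhile_notComma, filterMap_toMarked]
  simp [Function.comp_def]

theorem product_encode (r : RuleApp A) : product r.encode = r.result := by
  cases r with
  | concat x y =>
    rw [encode_concat, product, firstField_ruleString, secondField_ruleString rfl]
    simp [ruleString, isConcat, RuleApp.result, Function.comp_def]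
  | inst T S u =>
    rw [encode_inst, product, firstField_ruleString, secondField_ruleString rfl]
    simp [ruleString, isConcat, RuleApp.result, instantiate_eq]

theorem reencode_encode (r : RuleApp A) : reencode r.encode = r.encode := by
  rw [reencode, product_encode]
  cases r with
  | concat x y =>
    rw [encode_concat, firstField_ruleString, secondField_ruleString rfl]
    simp [isConcat, RuleApp.result, Function.comp_def, ruleString]
  | inst T S u =>
    rw [encode_inst, firstField_ruleString, secondField_ruleString rfl]
    simp [isConcat, RuleApp.result, ruleString]

theorem exists_encode_eq {c : List (CertSym A)} (hc : reencode c = c) :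
    ∃ r : RuleApp A, c = r.encode := by
  by_cases h : isConcat c
  · refine ⟨.concat ((firstField c).map Prod.fst) (secondField c), ?_⟩
    rw [encode_concat]
    conv_lhs => rw [← hc, reencode, product]
    simp [h, Function.comp_def]
  · obtain ⟨S, hS⟩ := exists_marked (firstField c)
    refine ⟨.inst ((firstField c).map Prod.fst) S (secondField c), ?_⟩
    rw [encode_inst, instantiate_eq, hS]
    conv_lhs => rw [← hc, reencode, product]
    simp [h]

theorem marked_any (T : List (Option A)) (S : Finset (Fin T.length)) :
    (marked T S).any (fun d => d.2) = true ↔ S.Nonempty := by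
  simp [marked, Finset.Nonempty]

theorem marked_all (T : List (Option A)) (S : Finset (Fin T.length)) :
    (marked T S).all (fun d => !d.2 || d.1.isNone) = true ↔
      (S : Set (Fin T.length)) ⊆ wildcards T := by
  simp [marked, wildcards, Set.subset_def, imp_iff_not_or]

end

/-! ### The test for a rule application -/

section

variable {A : Type} [DecidableEq A]

/-- The test for operands of a concatenation. -/
def concatOperandTest (w : List A) (x : List (Option A)) : Bool :=
  objectTest w x || decide (x = [none])

/-- The test for operands that are available. -/
def availableTest (prods : List (List (Option A))) (x : List (Option A)) : Bool :=
  (!x.isEmpty && x.tail.isEmpty) || decide (x ∈ prods)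

/-- The test for a string to describe an allowed rule application to monomers and elements of
`prods`. -/
noncomputable def ruleTest (w : List A) (prods : List (List (Option A))) (c : List (CertSym A)) :
    Bool :=
  decide (reencode c = c) && objectTest w (product c) &&
    (if isConcat c then
      concatOperandTest w ((firstField c).map Prod.fst) && concatOperandTest w (secondField c)
    else
      objectTest w ((firstField c).map Prod.fst) && (firstField c).any (fun d => d.2) &&
        (firstField c).all (fun d => !d.2 || d.1.isNone) && objectTest w (secondField c)) &&
    (availableTest prods ((firstField c).map Prod.fst) && availableTest prods (secondField c))

theorem availableTest_iff (prods : List (List (Option A))) (x : List (Option A)) :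
    availableTest prods x = true ↔ IsMonomer x ∨ x ∈ prods := by
  rw [availableTest, Bool.or_eq_true, decide_eq_true_eq]
  refine or_congr_left ?_
  rcases x with _ | ⟨a, _ | ⟨b, x⟩⟩ <;> simp [IsMonomer]

theorem concatOperandTest_iff (w : List A) (x : List (Option A)) :
    concatOperandTest w x = true ↔ x ∈ Objects w ∨ x = [none] := by
  rw [concatOperandTest, Bool.or_eq_true, decide_eq_true_eq, objectTest_iff]

theorem ruleTest_encode (w : List A) (prods : List (List (Option A))) (r : RuleApp A) :
    ruleTest w prods r.encode = true ↔
      r.Allowed w ∧ ∀ o ∈ r.operands, IsMonomer o ∨ o ∈ prods := by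
  rw [ruleTest, reencode_encode, product_encode]
  cases r with
  | concat x y =>
    rw [encode_concat, firstField_ruleString, secondField_ruleString rfl]
    have h : (x.map (·, false)).map Prod.fst = x := by simp [Function.comp_def]
    simp only [h, ruleString, isConcat, List.cons_append, if_true, Bool.and_eq_true,
      decide_true, objectTest_iff, concatOperandTest_iff, availableTest_iff, RuleApp.Allowed,
      RuleApp.operands, RuleApp.result, List.forall_mem_cons]
    simp
    tauto
  | inst T S u =>
    rw [encode_inst, firstField_ruleString, secondField_ruleString rfl, map_fst_marked]
    simp only [ruleString, isConcat, List.cons_append, Bool.false_eq_true, if_false,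
      Bool.and_eq_true, decide_true, objectTest_iff, availableTest_iff, RuleApp.Allowed,
      RuleApp.operands, RuleApp.result, List.forall_mem_cons, marked_any, marked_all]
    -- Only membership in `Objects w` is tested for `T`. As a chosen position carries a wildcard,
    -- `T` is then a template.
    have hT : S.Nonempty → (S : Set (Fin T.length)) ⊆ wildcards T →
        (T ∈ Templates w ↔ T ∈ Objects w) := by
      rintro ⟨p, hp⟩ hS
      rw [mem_templates_iff, mem_objects_iff]
      refine and_iff_right ?_
      have : T.get p = none := hS hp
      rw [← this]
      exact List.get_mem T p
    simp
    tauto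

theorem ruleTest_iff (w : List A) (prods : List (List (Option A))) (c : List (CertSym A)) :
    ruleTest w prods c = true ↔ ∃ r : RuleApp A, c = r.encode ∧ r.Allowed w ∧
      ∀ o ∈ r.operands, IsMonomer o ∨ o ∈ prods := by
  constructor
  · intro h
    have hc : reencode c = c := by
      simp only [ruleTest, Bool.and_eq_true, decide_eq_true_eq] at h
      exact h.1.1.1
    obtain ⟨r, rfl⟩ := exists_encode_eq hc
    exact ⟨r, rfl, (ruleTest_encode w prods r).1 h⟩
  · rintro ⟨r, rfl, h⟩
    exact (ruleTest_encode w prods r).2 h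

end

end TAssembly

namespace TAssembly

open Computability

/-! ### The test for certificates -/

section

variable {A : Type}

theorem instEnc_eq (eN : Encoding ℕ Bool) (w : List A) (k : ℕ) :
    instEnc eN (w, k) = w.map .inl ++ (eN.encode k).map .inr := rfl

theorem filterMap_getLeft {B : Type} (w : List A) (l : List B) :
    (w.map Sum.inl ++ l.map Sum.inr).filterMap Sum.getLeft? = w := by
  simp [List.filterMap_map, Function.comp_def]

theorem filterMap_getRight {B : Type} (w : List A) (l : List B) :
    (w.map Sum.inl ++ l.map Sum.inr).filterMap Sum.getRight? = l := by
  simp [List.filterMap_map, Function.comp_def]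

/-- The state of a loop that splits a certificate, from its end, before each tag. -/
def splitStep (s : CertSym A) (t : List (CertSym A) × List (List (CertSym A))) :
    List (CertSym A) × List (List (CertSym A)) :=
  if s.isTag then ([], (s :: t.1) :: t.2) else (s :: t.1, t.2)

/-- The symbols of a certificate before the first tag, and the parts that start with a tag. -/
def splitTags (c : List (CertSym A)) : List (CertSym A) × List (List (CertSym A)) :=
  c.foldr splitStep ([], [])

theorem splitTags_flatten (c : List (CertSym A)) :
    (splitTags c).1 ++ (splitTags c).2.flatten = c := by
  induction c with
  | nil => rfl
  | cons s c ih =>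
    rw [splitTags, List.foldr_cons, ← splitTags, splitStep]
    split_ifs <;> simp [ih]

theorem foldr_splitStep {l : List (CertSym A)} (hl : ∀ s ∈ l, s.isTag = false)
    (t : List (CertSym A) × List (List (CertSym A))) :
    l.foldr splitStep t = (l ++ t.1, t.2) := by
  induction l with
  | nil => rfl
  | cons s l ih =>
    rw [List.foldr_cons, ih fun s hs => hl s (by simp [hs]), splitStep,
      hl s (by simp)]
    simp

/-- A tag occurs only at the head of a rule string, so cutting before each tag recovers the
individual strings. -/
theorem foldr_splitStep_ruleString {t : CertSym A} (ht : t.isTag = true)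
    (m : List (Option A × Bool)) (u z : List (Option A)) (L : List (List (CertSym A))) :
    (ruleString t m u z).foldr splitStep ([], L) = ([], ruleString t m u z :: L) := by
  unfold ruleString
  rw [List.cons_append, List.cons_append, List.foldr_cons, foldr_splitStep, splitStep]
  · simp [ht]
  · intro s hs
    simp only [List.mem_append, List.mem_cons, List.mem_map, encodeObj] at hs
    rcases hs with ((⟨_, _, rfl⟩ | rfl | ⟨_, _, rfl⟩) | rfl | ⟨_, _, rfl⟩) <;> rfl

theorem splitTags_encode (rs : List (RuleApp A)) :
    splitTags (rs.flatMap RuleApp.encode) = ([], rs.map RuleApp.encode) := by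
  induction rs with
  | nil => rfl
  | cons r rs ih =>
    rw [List.flatMap_cons, splitTags, List.foldr_append, ← splitTags, ih, List.map_cons]
    cases r with
    | concat x y => rw [encode_concat]; exact foldr_splitStep_ruleString rfl _ _ _ _
    | inst T S u => rw [encode_inst]; exact foldr_splitStep_ruleString rfl _ _ _ _

/-- The rules are allowed, and the operands are monomers, elements of `prods` or products of earlier
rule applications. -/
def Valid (w : List A) : List (List (Option A)) → List (RuleApp A) → Prop
  | _, [] => True
  | prods, r :: rs => (r.Allowed w ∧ ∀ o ∈ r.operands, IsMonomer o ∨ o ∈ prods) ∧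
      Valid w (r.result :: prods) rs

/-- The recursive form, with an accumulator for the available products, is the one that a loop can
check; the indexed form is that of `Assembles`. -/
theorem valid_iff (w : List A) (prods : List (List (Option A))) (rs : List (RuleApp A)) :
    Valid w prods rs ↔ ∀ i : Fin rs.length, (rs.get i).Allowed w ∧
      ∀ o ∈ (rs.get i).operands, IsMonomer o ∨ o ∈ prods ∨ ∃ j < i, (rs.get j).result = o := by
  induction rs generalizing prods with
  | nil => simp [Valid]
  | cons r rs ih =>
    rw [Valid, ih]
    constructor
    · rintro ⟨h₁, h₂⟩ i
      refine Fin.cases ?_ (fun i => ?_) i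
      · exact ⟨h₁.1, fun o ho => (h₁.2 o ho).imp_right Or.inl⟩
      · refine ⟨(h₂ i).1, fun o ho => ?_⟩
        rcases (h₂ i).2 o ho with h | h | ⟨j, hj, h⟩
        · exact Or.inl h
        · rcases List.mem_cons.1 h with rfl | h
          · exact Or.inr (Or.inr ⟨0, Fin.succ_pos i, rfl⟩)
          · exact Or.inr (Or.inl h)
        · exact Or.inr (Or.inr ⟨j.succ, Fin.succ_lt_succ_iff.2 hj, h⟩)
    · intro h
      refine ⟨⟨(h 0).1, fun o ho => ?_⟩, fun i => ⟨(h i.succ).1, fun o ho => ?_⟩⟩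
      · rcases (h 0).2 o ho with h | h | ⟨j, hj, -⟩
        · exact Or.inl h
        · exact Or.inr h
        · exact absurd hj (Fin.not_lt_zero j)
      · rcases (h i.succ).2 o ho with h | h | ⟨j, hj, h⟩
        · exact Or.inl h
        · exact Or.inr (Or.inl (List.mem_cons_of_mem _ h))
        · revert hj h
          refine Fin.cases ?_ (fun j => ?_) j
          · rintro - rfl
            exact Or.inr (Or.inl List.mem_cons_self)
          · intro hj h
            exact Or.inr (Or.inr ⟨j, Fin.succ_lt_succ_iff.1 hj, h⟩)

theorem assembles_iff (rs : List (RuleApp A)) (w : List A) :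
    Assembles rs w ↔ Valid w [] rs ∧
      (IsMonomer (w.map some) ∨ w.map some ∈ rs.map RuleApp.result) := by
  rw [Assembles, valid_iff]
  simp

end

/-! ### The verifier as a loop over rule applications -/

section

variable {A : Type} [DecidableEq A]

/-- The state of a loop over the rule applications of a certificate: the products, and whether the
tests were passed. -/
noncomputable def planStep (w : List A) (s : List (List (Option A)) × Bool)
    (c : List (CertSym A)) : List (List (Option A)) × Bool :=
  if ruleTest w s.1 c then (product c :: s.1, s.2) else (s.1, false)

theorem foldl_planStep_false (w : List A) (L : List (List (CertSym A)))
    (prods : List (List (Option A))) : (L.foldl (planStep w) (prods, false)).2 = false := by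
  induction L generalizing prods with
  | nil => rfl
  | cons c L ih =>
    rw [List.foldl_cons, planStep]
    split_ifs <;> exact ih _

theorem foldl_planStep_encode (w : List A) (rs : List (RuleApp A))
    (prods : List (List (Option A))) (h : Valid w prods rs) :
    (rs.map RuleApp.encode).foldl (planStep w) (prods, true) =
      ((rs.map RuleApp.result).reverse ++ prods, true) := by
  induction rs generalizing prods with
  | nil => rfl
  | cons r rs ih =>
    rw [List.map_cons, List.foldl_cons, planStep, (ruleTest_encode w prods r).2 h.1,
      product_encode]
    simp only [if_true]
    rw [ih _ h.2]
    simp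

theorem exists_of_foldl_planStep (w : List A) (L : List (List (CertSym A)))
    (prods : List (List (Option A))) (h : (L.foldl (planStep w) (prods, true)).2 = true) :
    ∃ rs : List (RuleApp A), L = rs.map RuleApp.encode ∧ Valid w prods rs := by
  induction L generalizing prods with
  | nil => exact ⟨[], rfl, trivial⟩
  | cons c L ih =>
    rw [List.foldl_cons, planStep] at h
    split_ifs at h with hc
    · obtain ⟨r, rfl, hr⟩ := (ruleTest_iff w prods c).1 hc
      rw [product_encode] at h
      obtain ⟨rs, rfl, hrs⟩ := ih _ h
      exact ⟨r :: rs, rfl, hr, hrs⟩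
    · rw [foldl_planStep_false] at h
      exact absurd h (by simp)

/-- Counting down in an encoding of the natural numbers. -/
structure Counter (eN : Encoding ℕ Bool) where
  /-- The string encodes a number. -/
  valid : List Bool → Bool
  /-- The string encodes zero. -/
  isZero : List Bool → Bool
  /-- The predecessor. -/
  pred : List Bool → List Bool
  /-- The number. -/
  val : List Bool → ℕ
  valid_iff : ∀ l, valid l = true ↔ ∃ k, l = eN.encode k
  val_encode : ∀ k, val (eN.encode k) = k
  isZero_iff : ∀ l, isZero l = true ↔ val l = 0
  val_pred : ∀ l, val l ≠ 0 → val (pred l) = val l - 1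
  length_pred_le : ∀ l, (pred l).length ≤ l.length

variable {eN : Encoding ℕ Bool}

/-- The state of a loop that counts down. -/
def Counter.step (K : Counter eN) (s : List Bool × Bool) : List Bool × Bool :=
  if K.isZero s.1 then (s.1, false) else (K.pred s.1, s.2)

/-- The loop runs over the rule applications instead of up to `k`, so its length is bounded by the
certificate even if `k` is exponential in the length of its encoding. The flag is lost at the
attempt to decrement zero. -/
theorem Counter.foldl_step {E : Type} (K : Counter eN) (L : List E) (l : List Bool) (b : Bool) :
    (L.foldl (fun s _ => K.step s) (l, b)).2 = (b && decide (L.length ≤ K.val l)) := by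
  induction L generalizing l b with
  | nil => simp
  | cons c L ih =>
    rw [List.foldl_cons, step]
    split_ifs with h
    · rw [ih]
      simp [(K.isZero_iff l).1 h]
    · rw [ih]
      have h' : K.val l ≠ 0 := fun h' => h ((K.isZero_iff l).2 h')
      have : L.length ≤ K.val l - 1 ↔ L.length + 1 ≤ K.val l := by omega
      simp [K.val_pred l h', this]

/-- The test for certificates. -/
noncomputable def planTest (K : Counter eN) (s : List (A ⊕ Bool)) (c : List (CertSym A)) : Bool :=
  decide (s = (s.filterMap Sum.getLeft?).map .inl ++ (s.filterMap Sum.getRight?).map .inr) &&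
    K.valid (s.filterMap Sum.getRight?) && !(s.filterMap Sum.getLeft?).isEmpty &&
    (splitTags c).1.isEmpty &&
    ((splitTags c).2.foldl (planStep (s.filterMap Sum.getLeft?)) ([], true)).2 &&
    availableTest ((splitTags c).2.foldl (planStep (s.filterMap Sum.getLeft?)) ([], true)).1
      ((s.filterMap Sum.getLeft?).map some) &&
    ((splitTags c).2.foldl (fun t _ => K.step t) (s.filterMap Sum.getRight?, true)).2

theorem planTest_iff (K : Counter eN) (s : List (A ⊕ Bool)) (c : List (CertSym A)) :
    planTest K s c = true ↔ PlanVerifier eN s c := by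
  constructor
  · intro h
    simp only [planTest, Bool.and_eq_true, decide_eq_true_eq] at h
    obtain ⟨⟨⟨⟨⟨⟨h₁, h₂⟩, h₃⟩, h₄⟩, h₅⟩, h₆⟩, h₇⟩ := h
    set w := s.filterMap Sum.getLeft?
    obtain ⟨k, hk⟩ := (K.valid_iff _).1 h₂
    rw [hk] at h₁ h₇
    obtain ⟨rs, hL, hrs⟩ := exists_of_foldl_planStep w _ _ h₅
    rw [hL, foldl_planStep_encode w rs [] hrs, availableTest_iff] at h₆
    refine ⟨w, k, rs, ?_, h₁, ?_, (assembles_iff rs w).2 ⟨hrs, ?_⟩, ?_⟩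
    · intro hw
      simp [hw] at h₃
    · have := splitTags_flatten c
      rw [List.isEmpty_iff.1 h₄, hL, List.nil_append] at this
      rw [← this, List.flatMap_def]
    · simpa using h₆
    · rw [Counter.foldl_step, K.val_encode, hL] at h₇
      simpa using h₇
  · rintro ⟨w, k, rs, hw, rfl, rfl, h, hk⟩
    rw [assembles_iff] at h
    simp only [planTest, instEnc_eq, filterMap_getLeft, filterMap_getRight, splitTags_encode,
      foldl_planStep_encode w rs [] h.1, Counter.foldl_step, K.val_encode, Bool.and_eq_true,
      availableTest_iff]
    refine ⟨⟨⟨⟨⟨⟨by simp, (K.valid_iff _).2 ⟨k, rfl⟩⟩, ?_⟩, rfl⟩, trivial⟩, ?_⟩, ?_⟩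
    · simpa using hw
    · simpa using h.2
    · simpa using hk

end

end TAssembly

namespace TAssembly

open Computability

/-! ### The test for certificates in polynomial time -/

section

variable {A G α : Type} [Finite A] [Inhabited G] [StackRep G α] [Emb G (Option A)] [DecidableEq A]

theorem Comp.concatOperandTest [Emb G A] [Emb G (Option A × Bool)] {w : α → List A}
    {x : α → List (Option A)} (hw : Comp G w) (hx : Comp G x) :
    Comp G fun a => concatOperandTest (w a) (x a) :=
  (hw.objectTest hx).or (hx.decide_eq (.const_list _))

theorem Comp.availableTest [Emb G (Option (Option A))] {L : α → List (List (Option A))}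
    {x : α → List (Option A)} (hL : Comp G L) (hx : Comp G x) :
    Comp G fun a => availableTest (L a) (x a) :=
  (hx.decide_eq_nil.not.and hx.tail.decide_eq_nil).or
    ((hx.decide_mem hL).of_eq fun _ => decide_eq_decide.2 Iff.rfl)

end

section

/-- A well-formed string contains its product, so collecting products adds at most the length of the
string, plus a separator, to the state in `Comp.foldl_planStep`. -/
theorem length_product_le {A : Type} {c : List (CertSym A)} (hc : reencode c = c) :
    (product c).length ≤ c.length := by
  conv_rhs => rw [← hc, reencode]
  split_ifs <;> simp [ruleString, encodeObj] <;> omega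

variable {A G α : Type} [Finite A] [StackRep G α] [Emb G (CertSym A)]

theorem Comp.isConcat [Inhabited G] {c : α → List (CertSym A)} (hc : Comp G c) :
    Comp G fun a => isConcat (c a) :=
  (hc.listCase (h := fun _ s _ => TAssembly.isConcat [s]) .const_false
    fun s => .const_bool _).of_eq fun a => by
      rcases c a with _ | ⟨_ | _ | _ | _, l⟩ <;> rfl

theorem Comp.encodeObj [Emb G (Option A)] {x : α → List (Option A)} (hx : Comp G x) :
    Comp G fun a => encodeObj (x a) := hx.map _

variable [Emb G (Option A × Bool)]

theorem Comp.firstField {c : α → List (CertSym A)} (hc : Comp G c) :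
    Comp G fun a => firstField (c a) :=
  (hc.tail.takeWhile CertSym.notComma).filterMap CertSym.toMarked

variable [Emb G (Option A)]

theorem Comp.secondField [Inhabited G] {c : α → List (CertSym A)} (hc : Comp G c) :
    Comp G fun a => secondField (c a) :=
  (((hc.dropWhile CertSym.notComma).tail.takeWhile CertSym.notComma).filterMap
    CertSym.toMarked).map Prod.fst

theorem Comp.product [Inhabited G] {c : α → List (CertSym A)} (hc : Comp G c) :
    Comp G fun a => product (c a) := by
  refine hc.isConcat.ite ((hc.firstField.map Prod.fst).append hc.secondField)
    (hc.firstField.flatMap (F := fun a d => if d.2 then TAssembly.secondField (c a) else [d.1])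
      fun d => ?_)
  split_ifs
  · exact hc.secondField
  · exact .const_list _

theorem Comp.ruleString (t : CertSym A) {m : α → List (Option A × Bool)}
    {u z : α → List (Option A)} (hm : Comp G m) (hu : Comp G u) (hz : Comp G z) :
    Comp G fun a => ruleString t (m a) (u a) (z a) :=
  (((hm.map CertSym.ofMarked).cons_const t).append (hu.encodeObj.cons_const _)).append
    (hz.encodeObj.cons_const _)

theorem Comp.reencode [Inhabited G] {c : α → List (CertSym A)} (hc : Comp G c) :
    Comp G fun a => reencode (c a) :=
  hc.isConcat.ite (.ruleString _ (hc.firstField.map _) hc.secondField hc.product)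
    (.ruleString _ hc.firstField hc.secondField hc.product)

variable [Inhabited G] [DecidableEq A] [Emb G A] [Emb G (Option (Option A))]

theorem Comp.ruleTest {w : α → List A} {L : α → List (List (Option A))}
    {c : α → List (CertSym A)} (hw : Comp G w) (hL : Comp G L) (hc : Comp G c) :
    Comp G fun a => ruleTest (w a) (L a) (c a) := by
  have h₁ := hc.firstField.map Prod.fst
  have h₂ := hc.secondField
  have h₃ := hc.isConcat.ite ((hw.concatOperandTest h₁).and (hw.concatOperandTest h₂))
    ((((hw.objectTest h₁).and (hc.firstField.any (P := fun _ d => d.2) fun d => .const_bool _)).and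
      (hc.firstField.all (P := fun _ d => !d.2 || d.1.isNone) fun d => .const_bool _)).and
      (hw.objectTest h₂))
  have h₄ := (hc.reencode.decide_eq hc).and (hw.objectTest hc.product)
  have h₅ := (hL.availableTest h₁).and (hL.availableTest h₂)
  exact ((h₄.and h₃).and h₅).of_eq fun a => rfl

variable [Emb G (Option (CertSym A))]

theorem Comp.foldl_planStep {w : α → List A} {L : α → List (List (CertSym A))} (hw : Comp G w)
    (hL : Comp G L) : Comp G fun a => (L a).foldl (planStep (w a)) ([], true) := by
  refine Comp.foldl_lists (h := fun a => planStep (w a)) hL (Comp.nil_lists.pair .const_true) ?_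
    ⟨Polynomial.X + Polynomial.C 2, fun a s c => ?_⟩
  · exact (Comp.ruleTest (hw.comp Comp.fst'.fst) Comp.fst'.snd.fst .snd').ite
      ((Comp.snd'.product.cons_lists Comp.fst'.snd.fst).pair Comp.fst'.snd.snd)
      (Comp.fst'.snd.fst.pair .const_false)
  · obtain ⟨prods, b⟩ := s
    simp only [planStep, Polynomial.eval_add, Polynomial.eval_X, Polynomial.eval_C]
    split_ifs with h
    · have hc : TAssembly.reencode c = c := by
        simp only [TAssembly.ruleTest, Bool.and_eq_true, decide_eq_true_eq] at h
        exact h.1.1.1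
      have := length_product_le hc
      rw [size_prod, size_prod, size_cons_lists]
      omega
    · have := size_bool_le (G := G) false
      rw [size_prod, size_prod]
      omega

end

section

variable {A G α : Type} [Finite A] [StackRep G α] [Emb G (CertSym A)] [Emb G (Option (CertSym A))]

theorem Comp.splitTags {c : α → List (CertSym A)} (hc : Comp G c) :
    Comp G fun a => splitTags (c a) := by
  refine Comp.foldr_of_le (h := fun _ => splitStep) hc (Comp.nil.pair Comp.nil_lists) (fun s => ?_)
    ⟨Polynomial.C 2, fun a t s => ?_⟩
  · unfold splitStep
    split_ifs
    · exact Comp.nil.pair ((Comp.snd'.fst.cons_const s).cons_lists Comp.snd'.snd)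
    · exact (Comp.snd'.fst.cons_const s).pair Comp.snd'.snd
  · obtain ⟨l, L⟩ := t
    unfold splitStep
    split_ifs
    · simp only [size_prod, size_cons_lists, size_list, List.length_nil, List.length_cons,
        Polynomial.eval_C]
      omega
    · simp only [size_prod, size_list, List.length_cons, Polynomial.eval_C]
      omega

end

section

variable {A G α : Type} [Finite A] [DecidableEq A] [Inhabited G] [StackRep G α]
  [Emb G (CertSym A)] [Emb G (Option A × Bool)] [Emb G (Option A)] [Emb G A]
  [Emb G (Option (Option A))] [Emb G (Option (CertSym A))] [Emb G Bool] [Emb G (A ⊕ Bool)]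

theorem Comp.planTest {eN : Encoding ℕ Bool} {K : Counter eN} (hv : Comp G K.valid)
    (hz : Comp G K.isZero) (hp : Comp G K.pred) {s : α → List (A ⊕ Bool)}
    {c : α → List (CertSym A)} (hs : Comp G s) (hc : Comp G c) :
    Comp G fun a => planTest K (s a) (c a) := by
  have hw := hs.filterMap Sum.getLeft?
  have hk := hs.filterMap Sum.getRight?
  have hL := hc.splitTags.snd
  have hP := hw.foldl_planStep hL
  have hcount : Comp G fun a => (TAssembly.splitTags (c a)).2.foldl (fun t _ => K.step t)
      ((s a).filterMap Sum.getRight?, true) := by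
    refine Comp.foldl_lists (h := fun _ t _ => K.step t) hL (hk.pair .const_true) ?_
      ⟨Polynomial.C 1, fun a t _ => ?_⟩
    · exact (hz.comp Comp.fst'.snd.fst).ite (Comp.fst'.snd.fst.pair .const_false)
        ((hp.comp Comp.fst'.snd.fst).pair Comp.fst'.snd.snd)
    · obtain ⟨l, b⟩ := t
      have h₁ := size_bool_le (G := G) false
      have h₂ := K.length_pred_le l
      simp only [Counter.step, Polynomial.eval_C]
      split_ifs <;> simp only [size_prod, size_list] <;> omega
  exact ((((((hs.decide_eq ((hw.map Sum.inl).append (hk.map Sum.inr))).and (hv.comp hk)).and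
    hw.decide_eq_nil.not).and hc.splitTags.fst.decide_eq_nil).and hP.snd).and
    (hP.fst.availableTest (hw.map some))).and hcount.snd

end

/-! ### Counting down in unary and in binary -/

theorem unaryEncodeNat_eq (k : ℕ) : unaryEncodeNat k = List.replicate k true := by
  induction k with
  | zero => rfl
  | succ k ih => rw [unaryEncodeNat, ih, List.replicate_succ]

/-- Counting down in unary. -/
def unaryCounter : Counter unaryEncodingNat where
  valid l := l.all fun b => b
  isZero l := l.isEmpty
  pred l := l.tail
  val l := l.length
  valid_iff l := by
    simp only [unaryEncodingNat, unaryEncodeNat_eq, List.all_eq_true]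
    constructor
    · intro h
      exact ⟨l.length, List.eq_replicate_iff.2 ⟨rfl, h⟩⟩
    · rintro ⟨k, rfl⟩ b hb
      exact List.eq_of_mem_replicate hb
  val_encode k := by simp [unaryEncodingNat, unaryEncodeNat_eq]
  isZero_iff l := by simp
  val_pred l _ := by simp
  length_pred_le l := by simp

/-- The number with the given binary digits, the least significant one first. -/
def binVal : List Bool → ℕ
  | [] => 0
  | b :: l => b.toNat + 2 * binVal l

/-- Subtracts the borrow from the number with the given binary digits. -/
def binPred : Bool → List Bool → List Bool
  | _, [] => []
  | b, c :: l => (c ^^ b) :: binPred (b && !c) l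

/-- A borrow that remains after the last digit is dropped; the hypothesis says that none remains. -/
theorem binVal_binPred (b : Bool) (l : List Bool) (h : b.toNat ≤ binVal l) :
    binVal (binPred b l) + b.toNat = binVal l := by
  induction l generalizing b with
  | nil => simpa [binVal, binPred] using h
  | cons c l ih =>
    have h' : (b && !c).toNat ≤ binVal l := by
      cases b <;> cases c <;> simp_all [binVal]
      omega
    have := ih _ h'
    clear ih h'
    cases b <;> cases c <;> simp [binVal, binPred] at h this ⊢ <;> omega

theorem length_binPred (b : Bool) (l : List Bool) : (binPred b l).length = l.length := by
  induction l generalizing b with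
  | nil => rfl
  | cons c l ih => simp [binPred, ih]

theorem binVal_eq_zero_iff (l : List Bool) : binVal l = 0 ↔ (l.all fun b => !b) = true := by
  induction l with
  | nil => simp [binVal]
  | cons c l ih => cases c <;> simp [binVal, ih]

theorem binVal_encodePosNum (p : PosNum) : binVal (encodePosNum p) = p := by
  induction p with
  | one => rfl
  | bit1 p ih => simp [encodePosNum, binVal, ih]; ring
  | bit0 p ih => simp [encodePosNum, binVal, ih]; ring

theorem binVal_encodeNat (n : ℕ) : binVal (encodeNat n) = n := by
  conv_rhs => rw [← Num.to_of_nat n]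
  rw [encodeNat]
  cases (n : Num) with
  | zero => rfl
  | pos p => exact binVal_encodePosNum p

/-- The fold returns the last digit, which is the most significant one and hence `true` for a
positive number. -/
theorem foldl_encodePosNum (p : PosNum) : (encodePosNum p).foldl (fun _ b => b) true = true := by
  induction p with
  | one => rfl
  | bit1 p ih => simpa [encodePosNum] using ih
  | bit0 p ih =>
    rw [encodePosNum]
    cases h : encodePosNum p with
    | nil => exact absurd h (encodePosNum_nonempty p)
    | cons b l =>
      rw [h] at ih
      simpa using ih

theorem exists_encodePosNum {l : List Bool} (hl : l ≠ [])
    (h : l.foldl (fun _ b => b) true = true) : ∃ p, l = encodePosNum p := by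
  induction l with
  | nil => exact absurd rfl hl
  | cons b l ih =>
    cases l with
    | nil =>
      obtain rfl : b = true := h
      exact ⟨.one, rfl⟩
    | cons c l =>
      obtain ⟨p, hp⟩ := ih (by simp) (by simpa using h)
      rw [hp]
      cases b
      · exact ⟨.bit0 p, rfl⟩
      · exact ⟨.bit1 p, rfl⟩

/-- Counting down in binary. -/
def binCounter : Counter encodingNatBool where
  -- Canonical strings end in `true` or are empty; the initial value `true` accepts the empty
  -- string, which encodes zero.
  valid l := l.foldl (fun _ b => b) true
  -- Decrementing keeps the number of digits, so zero shows up as a string of zeros and canonicity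
  -- is lost; `valid` is therefore only applied to the original input.
  isZero l := l.all fun b => !b
  pred l := binPred true l
  val l := binVal l
  valid_iff l := by
    constructor
    · intro h
      by_cases hl : l = []
      · exact ⟨0, by subst hl; rfl⟩
      · obtain ⟨p, rfl⟩ := exists_encodePosNum hl h
        refine ⟨p, ?_⟩
        change _ = encodeNum ((p : ℕ) : Num)
        rw [PosNum.of_to_nat]
        rfl
    · rintro ⟨k, rfl⟩
      change (encodeNum (k : Num)).foldl _ _ = true
      cases (k : Num) with
      | zero => rfl
      | pos p => exact foldl_encodePosNum p
  val_encode k := binVal_encodeNat k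
  isZero_iff l := (binVal_eq_zero_iff l).symm
  val_pred l hl := by
    have := binVal_binPred true l (by simp; omega)
    simp at this
    omega
  length_pred_le l := (length_binPred true l).le

section

variable {G : Type} [Inhabited G] [Emb G Bool]

theorem comp_unaryCounter : Comp G unaryCounter.valid ∧ Comp G unaryCounter.isZero ∧
    Comp G unaryCounter.pred :=
  ⟨Comp.id.all (P := fun _ b => b) fun _ => .const_bool _, Comp.id.decide_eq_nil, Comp.id.tail⟩

/-- The state of a loop that computes `binPred`. -/
def binPredStep (s : Bool × List Bool) (c : Bool) : Bool × List Bool :=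
  (s.1 && !c, (c ^^ s.1) :: s.2)

theorem foldl_binPredStep (l t : List Bool) (b : Bool) :
    (l.foldl binPredStep (b, t)).2.reverse = t.reverse ++ binPred b l := by
  induction l generalizing b t with
  | nil => simp [binPred]
  | cons c l ih => simp [binPredStep, ih, binPred]

theorem comp_binCounter : Comp G binCounter.valid ∧ Comp G binCounter.isZero ∧
    Comp G binCounter.pred := by
  refine ⟨?_, Comp.id.all (P := fun _ b => !b) fun _ => .const_bool _, ?_⟩
  · refine Comp.foldl_of_le (h := fun _ _ b => b) Comp.id .const_true (fun b => .const_bool b)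
      ⟨1, fun a s c => ?_⟩
    have := size_bool_le (G := G) c
    simp only [Polynomial.eval_one]
    omega
  · have h : Comp G fun l : List Bool => l.foldl binPredStep (true, []) := by
      refine Comp.foldl_of_le (h := fun _ => binPredStep) Comp.id (Comp.const_true.pair .nil)
        (fun c => ?_) ⟨Polynomial.C 2, fun a s c => ?_⟩
      · refine Comp.pair (Comp.snd'.fst.and (.const_bool _))
          ((Comp.snd'.fst.ite (Comp.snd'.snd.cons_const (c ^^ true))
            (Comp.snd'.snd.cons_const (c ^^ false))).of_eq fun p => ?_)
        cases p.2.1 <;> simp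
      · obtain ⟨b, t⟩ := s
        have := size_bool_le (G := G) (b && !c)
        simp only [binPredStep, size_prod, size_list, List.length_cons, Polynomial.eval_C]
        omega
    refine h.snd.reverse.of_eq fun l => ?_
    rw [foldl_binPredStep]
    rfl

end

end TAssembly

namespace TAssembly

open Computability

/-! ### A common stack alphabet -/

/-- The symbols of a type with at most as many elements as `G` are represented by symbols
in `G`. -/
@[reducible]
noncomputable def Emb.ofCardLE {G C : Type} [Finite G] [Finite C] (h : Nat.card C ≤ Nat.card G) :
    Emb G C := by
  classical
  let f : C ↪ G := Classical.choice <| by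
    have := Fintype.ofFinite C
    have := Fintype.ofFinite G
    exact Function.Embedding.nonempty_of_card_le (by simpa using h)
  exact
    { emb := f
      inv := fun g => if h : ∃ c, f c = g then some h.choose else none
      inv_emb := fun c => by
        have h : ∃ c', f c' = f c := ⟨c, rfl⟩
        rw [dif_pos h, f.injective h.choose_spec] }

variable (A : Type) [Finite A]

theorem polyTimeDecidable_mem_objects :
    PolyTimeDecidable (pairEnc A (Option A)) (fun z => z.2 ∈ Objects z.1) := by
  classical
  -- The sum of the cardinalities leaves room for each alphabet separately; the final `1` makes `G`
  -- inhabited.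
  let G := Fin (Nat.card A + Nat.card (Option A) + Nat.card (Option A × Bool) +
    Nat.card (A ⊕ Option A) + 1)
  have : Inhabited G := ⟨0⟩
  have : Finite G := inferInstanceAs (Finite (Fin _))
  have hG : Nat.card G = _ := Nat.card_fin _
  have : Emb G A := .ofCardLE (by omega)
  have : Emb G (Option A) := .ofCardLE (by omega)
  have : Emb G (Option A × Bool) := .ofCardLE (by omega)
  have : Emb G (A ⊕ Option A) := .ofCardLE (by omega)
  -- Undoes the reversal caused by loading the input.
  have h : Comp G fun l : List (A ⊕ Option A) => l.reverse := Comp.id.reverse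
  refine polyTimeDecidable_of_comp
    ((h.filterMap Sum.getLeft?).objectTest (h.filterMap Sum.getRight?)) fun z => ?_
  rw [List.reverse_reverse, objectTest_iff]
  change (z.1.map Sum.inl ++ z.2.map Sum.inr).filterMap Sum.getRight? ∈
    Objects ((z.1.map Sum.inl ++ z.2.map Sum.inr).filterMap Sum.getLeft?) ↔ _
  rw [filterMap_getLeft, filterMap_getRight]

theorem polyTimeDecidable_planVerifier {eN : Encoding ℕ Bool} (K : Counter eN)
    (hK : ∀ G : Type, ∀ [Inhabited G] [Emb G Bool],
      Comp G K.valid ∧ Comp G K.isZero ∧ Comp G K.pred) :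
    PolyTimeDecidable (pairEnc (A ⊕ Bool) (CertSym A)) (fun z => PlanVerifier eN z.1 z.2) := by
  classical
  let G := Fin (Nat.card A + Nat.card (Option A) + Nat.card (Option A × Bool) +
    Nat.card (Option (Option A)) + Nat.card Bool + Nat.card (A ⊕ Bool) + Nat.card (CertSym A) +
    Nat.card (Option (CertSym A)) + Nat.card ((A ⊕ Bool) ⊕ CertSym A) + 1)
  have : Inhabited G := ⟨0⟩
  have : Finite G := inferInstanceAs (Finite (Fin _))
  have hG : Nat.card G = _ := Nat.card_fin _
  have : Emb G A := .ofCardLE (by omega)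
  have : Emb G (Option A) := .ofCardLE (by omega)
  have : Emb G (Option A × Bool) := .ofCardLE (by omega)
  have : Emb G (Option (Option A)) := .ofCardLE (by omega)
  have : Emb G Bool := .ofCardLE (by omega)
  have : Emb G (A ⊕ Bool) := .ofCardLE (by omega)
  have : Emb G (CertSym A) := .ofCardLE (by omega)
  have : Emb G (Option (CertSym A)) := .ofCardLE (by omega)
  have : Emb G ((A ⊕ Bool) ⊕ CertSym A) := .ofCardLE (by omega)
  obtain ⟨hv, hz, hp⟩ := hK G
  have h : Comp G fun l : List ((A ⊕ Bool) ⊕ CertSym A) => l.reverse := Comp.id.reverse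
  refine polyTimeDecidable_of_comp
    (Comp.planTest hv hz hp (h.filterMap Sum.getLeft?) (h.filterMap Sum.getRight?)) fun z => ?_
  rw [List.reverse_reverse, planTest_iff]
  change PlanVerifier eN ((z.1.map Sum.inl ++ z.2.map Sum.inr).filterMap Sum.getLeft?)
    ((z.1.map Sum.inl ++ z.2.map Sum.inr).filterMap Sum.getRight?) ↔ _
  rw [filterMap_getLeft, filterMap_getRight]

theorem polyTimeDecidable_planVerifier_unary :
    PolyTimeDecidable (pairEnc (A ⊕ Bool) (CertSym A))
      (fun z => PlanVerifier unaryEncodingNat z.1 z.2) :=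
  polyTimeDecidable_planVerifier A unaryCounter fun _ => comp_unaryCounter

theorem polyTimeDecidable_planVerifier_binary :
    PolyTimeDecidable (pairEnc (A ⊕ Bool) (CertSym A))
      (fun z => PlanVerifier encodingNatBool z.1 z.2) :=
  polyTimeDecidable_planVerifier A binCounter fun _ => comp_binCounter

end TAssembly

namespace TAssembly

open Computability

/-! ### Plans and certificates -/

variable {A : Type}

/-- Each wildcard stands for at least one letter, so compression never lengthens a string. -/
theorem Matches.length_le {x : List (Option A)} {u : List A} (h : Matches x u) :
    x.length ≤ u.length := by
  induction h with
  | nil => rfl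
  | letter a _ ih => simpa using ih
  | wildcard hv _ ih =>
    have := List.length_pos_iff.2 hv
    simp only [List.length_append, List.length_singleton]
    omega

theorem length_le_of_mem_objects {w : List A} {x : List (Option A)} (hx : x ∈ Objects w) :
    x.length ≤ w.length := by
  obtain ⟨-, u, hu, h⟩ := mem_objects_iff.1 hx
  exact h.length_le.trans hu.length_le

theorem ne_nil_of_mem_objects {w : List A} {x : List (Option A)} (hx : x ∈ Objects w) :
    x ≠ [] := by
  obtain ⟨⟨a, ha⟩, -⟩ := mem_objects_iff.1 hx
  exact List.ne_nil_of_mem ha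

theorem mem_objects_of_infix {w u : List A} (h : u <:+: w) (hu : u ≠ []) :
    u.map some ∈ Objects w :=
  Or.inl ⟨u, hu, h, rfl⟩

theorem length_le_length_instantiate (T : List (Option A)) (S : Finset (Fin T.length))
    {u : List (Option A)} (hu : u ≠ []) : T.length ≤ (instantiate T S u).length := by
  rw [instantiate, List.length_flatMap]
  calc T.length = ((List.finRange T.length).map fun _ => 1).sum := by simp
    _ ≤ _ := List.sum_le_sum fun p _ => by
      have := List.length_pos_iff.2 hu
      split_ifs
      · exact this
      · simp

/-! ### Sizes of allowed rule applications -/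

namespace RuleApp.Allowed

variable {w : List A} {r : RuleApp A}

theorem operands_mem (h : r.Allowed w) {o : List (Option A)} (ho : o ∈ r.operands) :
    o ∈ Objects w ∨ o = [none] := by
  cases r with
  | concat x y =>
    simp only [RuleApp.operands, List.mem_cons, List.not_mem_nil, or_false] at ho
    rcases ho with rfl | rfl
    exacts [h.1, h.2.1]
  | inst T S u =>
    simp only [RuleApp.operands, List.mem_cons, List.not_mem_nil, or_false] at ho
    rcases ho with rfl | rfl
    exacts [Or.inl (Or.inr h.1), Or.inl h.2.2.2.1]

theorem result_mem (h : r.Allowed w) : r.result ∈ Objects w := by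
  cases r with
  | concat x y => exact h.2.2
  | inst T S u => exact h.2.2.2.2

/-- A concatenation has two non-empty operands. A template contains both a wildcard and a letter,
and instantiation does not shorten it. Hence monomers are never composite steps and cost nothing in
a plan. -/
theorem two_le_length_result (h : r.Allowed w) : 2 ≤ r.result.length := by
  cases r with
  | concat x y =>
    have hpos : ∀ z, z ∈ Objects w ∨ z = [none] → 0 < z.length := by
      rintro z (hz | rfl)
      exacts [List.length_pos_iff.2 (ne_nil_of_mem_objects hz), by simp]
    have h₁ := hpos x h.1
    have h₂ := hpos y h.2.1
    simp only [RuleApp.result, List.length_append]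
    omega
  | inst T S u =>
    refine le_trans ?_ (length_le_length_instantiate T S (ne_nil_of_mem_objects h.2.2.2.1))
    obtain ⟨h₁, ⟨a, h₂⟩, -⟩ := mem_templates_iff.1 h.1
    rcases T with _ | ⟨c, _ | ⟨d, T⟩⟩
    · simp at h₁
    · simp only [List.mem_singleton] at h₁ h₂
      simp [← h₁] at h₂
    · simp

theorem not_isMonomer_result (h : r.Allowed w) : ¬ IsMonomer r.result := by
  rintro ⟨a, ha⟩
  have := h.two_le_length_result
  simp [ha] at this

/-- Three strings of length at most `|w|`, one tag and two separators. -/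
theorem length_encode_le (h : r.Allowed w) : r.encode.length ≤ 3 * w.length + 3 := by
  have hr := length_le_of_mem_objects h.result_mem
  have h₂ := h.two_le_length_result
  have ho : ∀ o ∈ r.operands, o.length ≤ w.length := by
    intro o ho
    rcases h.operands_mem ho with ho | rfl
    · exact length_le_of_mem_objects ho
    -- The bare wildcard is not an object, but the product has length at least two and fits into
    -- `w`, so `1 ≤ |w|`.
    · rw [List.length_singleton]
      omega
  cases r with
  | concat x y =>
    have hx := ho x (by simp [RuleApp.operands])
    have hy := ho y (by simp [RuleApp.operands])
    simp only [RuleApp.result, List.length_append] at hr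
    simp only [RuleApp.encode, encodeObj, List.length_append, List.length_cons, List.length_map]
    omega
  | inst T S u =>
    have hx := ho T (by simp [RuleApp.operands])
    have hy := ho u (by simp [RuleApp.operands])
    simp only [RuleApp.result] at hr
    simp only [RuleApp.encode, encodeObj, List.length_append, List.length_cons, List.length_map,
      List.length_finRange]
    omega

end RuleApp.Allowed

/-- The indices of the members of `xs` that are obtained by applying a rule to earlier members. -/
def compositeSteps (w : List A) (xs : List (List (Option A))) : Set ℕ :=
  {n | ∃ r : RuleApp A, r.Allowed w ∧ xs[n]? = some r.result ∧ ∀ o ∈ r.operands, o ∈ xs.take n}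

theorem byRule_iff {w : List A} {xs : List (List (Option A))} {i : Fin xs.length} :
    ByRule w xs i ↔ (i : ℕ) ∈ compositeSteps w xs := by
  refine exists_congr fun r => and_congr_right fun _ => and_congr ?_ ?_
  · rw [List.getElem?_eq_getElem i.2, Option.some_inj]
    exact eq_comm
  · refine forall₂_congr fun o _ => ?_
    rw [List.mem_take_iff_getElem]
    constructor
    · rintro ⟨j, hj, rfl⟩
      exact ⟨j, lt_min hj j.2, rfl⟩
    · rintro ⟨j, hj, rfl⟩
      exact ⟨⟨j, (lt_min_iff.1 hj).2⟩, (lt_min_iff.1 hj).1, rfl⟩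

theorem lt_length_of_mem_compositeSteps {w : List A} {xs : List (List (Option A))} {n : ℕ}
    (h : n ∈ compositeSteps w xs) : n < xs.length := by
  obtain ⟨r, -, h, -⟩ := h
  exact (List.getElem?_eq_some_iff.1 h).1

theorem finite_compositeSteps (w : List A) (xs : List (List (Option A))) :
    (compositeSteps w xs).Finite :=
  (Set.finite_lt_nat xs.length).subset fun _ => lt_length_of_mem_compositeSteps

theorem planCost_eq (w : List A) (xs : List (List (Option A))) :
    planCost w xs = (compositeSteps w xs).ncard := by
  rw [planCost, ← Set.ncard_image_of_injective _ Fin.val_injective]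
  congr 1
  ext n
  constructor
  · rintro ⟨i, hi, rfl⟩
    exact byRule_iff.1 hi
  · intro hn
    exact ⟨⟨n, lt_length_of_mem_compositeSteps hn⟩, byRule_iff.2 hn, rfl⟩

theorem valid_append_singleton {w : List A} {prods : List (List (Option A))}
    {rs : List (RuleApp A)} {r : RuleApp A} (h : Valid w prods rs) (hr : r.Allowed w)
    (ho : ∀ o ∈ r.operands, IsMonomer o ∨ o ∈ prods ∨ o ∈ rs.map RuleApp.result) :
    Valid w prods (rs ++ [r]) := by
  induction rs generalizing prods with
  | nil => exact ⟨⟨hr, fun o h => by simpa using ho o h⟩, trivial⟩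
  | cons r' rs ih =>
    refine ⟨h.1, ih h.2 fun o h => ?_⟩
    have := ho o h
    simp only [List.map_cons, List.mem_cons] at this ⊢
    tauto

/-- The composite steps of a plan, in order, are a valid sequence of rule applications. -/
theorem exists_valid_of_plan {w : List A} {xs : List (List (Option A))}
    (h : ∀ n (hn : n < xs.length), IsMonomer xs[n] ∨ n ∈ compositeSteps w xs) :
    ∃ rs : List (RuleApp A), rs.length ≤ (compositeSteps w xs).ncard ∧ Valid w [] rs ∧
      ∀ x ∈ xs, IsMonomer x ∨ x ∈ rs.map RuleApp.result := by
  induction xs using List.reverseRecOn with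
  | nil => exact ⟨[], by simp, trivial, by simp⟩
  | append_singleton xs x ih =>
    -- Whether index `n` is composite depends only on the members up to `n`, so appending a member
    -- does not affect earlier indices.
    have hiff : ∀ n < xs.length,
        n ∈ compositeSteps w (xs ++ [x]) ↔ n ∈ compositeSteps w xs := by
      intro n hn
      simp only [compositeSteps, Set.mem_ofPred_eq, List.getElem?_append_left hn,
        List.take_append_of_le_length hn.le]
    have hsub : compositeSteps w xs ⊆ compositeSteps w (xs ++ [x]) := fun n hn =>
      (hiff n (lt_length_of_mem_compositeSteps hn)).2 hn
    obtain ⟨rs, hlen, hrs, hx⟩ := ih fun n hn => by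
      have := h n (by simp; omega)
      rwa [List.getElem_append_left hn, hiff n hn] at this
    by_cases hc : xs.length ∈ compositeSteps w (xs ++ [x])
    · have hcard : (compositeSteps w xs).ncard + 1 ≤ (compositeSteps w (xs ++ [x])).ncard := by
        rw [← Set.ncard_insert_of_notMem
          (fun h => (lt_length_of_mem_compositeSteps h).ne rfl) (finite_compositeSteps w xs)]
        exact Set.ncard_le_ncard (Set.insert_subset hc hsub) (finite_compositeSteps _ _)
      obtain ⟨r, hr, hres, ho⟩ := hc
      simp only [List.getElem?_concat_length, Option.some_inj, List.take_left] at hres ho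
      refine ⟨rs ++ [r], ?_, valid_append_singleton hrs hr fun o h => ?_, fun y hy => ?_⟩
      · rw [List.length_append, List.length_singleton]
        omega
      · exact (hx o (ho o h)).imp_right Or.inr
      · rcases List.mem_append.1 hy with hy | hy
        · exact (hx y hy).imp_right fun h => by simp [h]
        · right
          simp [List.mem_singleton.1 hy, hres]
    · refine ⟨rs, hlen.trans (Set.ncard_le_ncard hsub (finite_compositeSteps _ _)), hrs,
        fun y hy => ?_⟩
      rcases List.mem_append.1 hy with hy | hy
      · exact hx y hy
      · rw [List.mem_singleton.1 hy]
        have := (h xs.length (by simp)).resolve_right hc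
        left
        simpa using this

/-- Every string is assembled letter by letter. -/
theorem exists_valid_of_prefix {w u : List A} (hu : u <+: w) (hne : u ≠ []) :
    ∃ rs : List (RuleApp A), rs.length + 1 = u.length ∧ Valid w [] rs ∧
      (IsMonomer (u.map some) ∨ u.map some ∈ rs.map RuleApp.result) := by
  induction u using List.reverseRecOn with
  | nil => exact absurd rfl hne
  | append_singleton v a ih =>
    by_cases hv : v = []
    · subst hv
      exact ⟨[], rfl, trivial, Or.inl ⟨some a, rfl⟩⟩
    · have hvw : v <+: w := (List.prefix_append v [a]).trans hu
      obtain ⟨rs, hlen, hrs, hmem⟩ := ih hvw hv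
      have hr : (RuleApp.concat (v.map some) [some a]).Allowed w := by
        refine ⟨Or.inl (mem_objects_of_infix hvw.isInfix hv), Or.inl ?_, ?_⟩
        · exact mem_objects_of_infix ((List.suffix_append v [a]).isInfix.trans hu.isInfix)
            (by simp)
        · simpa using mem_objects_of_infix hu.isInfix hne
      refine ⟨rs ++ [_], by simp [hlen], valid_append_singleton hrs hr ?_, Or.inr ?_⟩
      · simp only [RuleApp.operands, List.mem_cons, List.not_mem_nil, or_false]
        rintro o (rfl | rfl)
        · exact hmem.imp_right Or.inr
        · exact Or.inl ⟨some a, rfl⟩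
      · simp [RuleApp.result]

/-- The bound by `|w|` is what keeps certificates short when `k` is in binary. If extraction from
the plan gives more than `|w|` applications, the letter-by-letter assembly is shorter, hence also
within the cost. -/
theorem exists_assembles_of_isPlan {w : List A} (hw : w ≠ []) {xs : List (List (Option A))}
    (h : IsPlan w xs) : ∃ rs : List (RuleApp A), Assembles rs w ∧ rs.length ≤ planCost w xs ∧
      rs.length ≤ w.length := by
  obtain ⟨rs, hlen, hrs, hmem⟩ := exists_valid_of_plan (w := w) (xs := xs) fun n hn =>
    (h.2.1 ⟨n, hn⟩).imp_right byRule_iff.1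
  rw [← planCost_eq] at hlen
  by_cases hle : rs.length ≤ w.length
  · exact ⟨rs, (assembles_iff rs w).2 ⟨hrs, hmem _ h.2.2⟩, hlen, hle⟩
  · obtain ⟨rs', hlen', hrs', hmem'⟩ := exists_valid_of_prefix (List.prefix_refl w) hw
    exact ⟨rs', (assembles_iff rs' w).2 ⟨hrs', hmem'⟩, by omega, by omega⟩

/-- All monomers that are used come first, followed by the products in order. Only indices of the
second part can be composite. -/
theorem exists_isPlan_of_assembles {w : List A} (hw : w ≠ []) {rs : List (RuleApp A)}
    (h : Assembles rs w) : ∃ xs, IsPlan w xs ∧ planCost w xs ≤ rs.length := by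
  classical
  -- `w` itself is included for the case that it is a single letter and no rule need be applied.
  let M := (w.map some :: rs.flatMap RuleApp.operands).filter fun x => decide (IsMonomer x)
  have hM : ∀ x, x ∈ M ↔ (x = w.map some ∨ ∃ r ∈ rs, x ∈ r.operands) ∧ IsMonomer x := by
    simp [M, List.mem_filter]
  have hall : ∀ r ∈ rs, r.Allowed w := fun r hr => by
    obtain ⟨i, rfl⟩ := List.get_of_mem hr
    exact (h.1 i).1
  refine ⟨M ++ rs.map RuleApp.result, ⟨?_, ?_, ?_⟩, ?_⟩
  · intro x hx
    rcases List.mem_append.1 hx with hx | hx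
    · rcases ((hM x).1 hx).1 with rfl | ⟨r, hr, hx⟩
      · exact Or.inl (mem_objects_of_infix List.infix_rfl hw)
      · exact (hall r hr).operands_mem hx
    · obtain ⟨r, hr, rfl⟩ := List.mem_map.1 hx
      exact Or.inl (hall r hr).result_mem
  · rintro ⟨n, hn⟩
    rw [byRule_iff]
    by_cases hlt : n < M.length
    · left
      rw [List.get_eq_getElem, List.getElem_append_left hlt]
      exact ((hM _).1 (List.getElem_mem hlt)).2
    · right
      obtain ⟨m, rfl⟩ := Nat.exists_eq_add_of_le (not_lt.1 hlt)
      have hm : m < rs.length := by simpa using hn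
      obtain ⟨hr, ho⟩ := h.1 ⟨m, hm⟩
      refine ⟨rs[m], hr, by simp [hm], fun o hmem => ?_⟩
      simp only [List.take_length_add_append]
      rcases ho o hmem with hmon | ⟨j, hj, rfl⟩
      · exact List.mem_append_left _
          ((hM o).2 ⟨Or.inr ⟨_, List.getElem_mem hm, hmem⟩, hmon⟩)
      · refine List.mem_append_right _ (List.mem_take_iff_getElem.2 ⟨j, ?_, by simp⟩)
        have : (j : ℕ) < m := hj
        simp
        omega
  · rw [List.mem_append]
    rcases h.2 with hmon | ⟨r, hr, he⟩
    · exact Or.inl ((hM _).2 ⟨Or.inl rfl, hmon⟩)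
    · exact Or.inr (he ▸ List.mem_map_of_mem hr)
  · rw [planCost_eq]
    calc _ ≤ (Set.Ico M.length (M.length + rs.length)).ncard := by
          refine Set.ncard_le_ncard (fun n hn => ⟨?_, ?_⟩) (Set.finite_Ico _ _)
          · obtain ⟨r, hr, he, -⟩ := hn
            by_contra hlt
            rw [List.getElem?_append_left (not_le.1 hlt), List.getElem?_eq_some_iff] at he
            obtain ⟨hlt, he⟩ := he
            exact hr.not_isMonomer_result (he ▸ ((hM _).1 (List.getElem_mem hlt)).2)
          · simpa using lt_length_of_mem_compositeSteps hn
      _ = rs.length := by simp [Set.ncard_eq_toFinset_card']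

theorem length_flatMap_encode_le {w : List A} {rs : List (RuleApp A)}
    (h : ∀ r ∈ rs, r.Allowed w) :
    (rs.flatMap RuleApp.encode).length ≤ rs.length * (3 * w.length + 3) := by
  induction rs with
  | nil => simp
  | cons r rs ih =>
    have h₁ := (h r (by simp)).length_encode_le
    have h₂ := ih fun r hr => h r (by simp [hr])
    rw [List.flatMap_cons, List.length_append, List.length_cons, Nat.succ_mul]
    omega

/-- The polynomial `X * (3 * X + 3)` counts at most `|w|` applications of at most `3 * |w| + 3`
symbols each. Soundness does not need the bound on the length. -/
theorem mem_taiDec_iff (eN : Encoding ℕ Bool) (s : List (A ⊕ Bool)) :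
    s ∈ TAIDec A eN ↔ ∃ c : List (CertSym A),
      c.length ≤ (Polynomial.X * (3 * Polynomial.X + 3) : Polynomial ℕ).eval s.length ∧
        PlanVerifier eN s c := by
  constructor
  · rintro ⟨w, k, hw, rfl, xs, hxs, hk⟩
    obtain ⟨rs, hrs, hcost, hlen⟩ := exists_assembles_of_isPlan hw hxs
    refine ⟨_, ?_, w, k, rs, hw, rfl, rfl, hrs, hcost.trans hk⟩
    have h₁ : w.length ≤ (instEnc eN (w, k)).length := by
      simp [instEnc_eq]
    have h₂ : ∀ r ∈ rs, r.Allowed w := fun r hr => by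
      obtain ⟨i, rfl⟩ := List.get_of_mem hr
      exact (hrs.1 i).1
    refine (length_flatMap_encode_le h₂).trans ?_
    simp only [Polynomial.eval_mul, Polynomial.eval_add, Polynomial.eval_X,
      Polynomial.eval_ofNat]
    gcongr
    exact hlen.trans h₁
  · rintro ⟨c, -, w, k, rs, hw, rfl, -, hrs, hk⟩
    obtain ⟨xs, hxs, hcost⟩ := exists_isPlan_of_assembles hw hrs
    exact ⟨w, k, hw, rfl, xs, hxs, hcost.trans hk⟩

theorem isNPVerifier_unary (A : Type) [Finite A] :
    IsNPVerifier (TAIDec A unaryEncodingNat) (PlanVerifier unaryEncodingNat) :=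
  ⟨polyTimeDecidable_planVerifier_unary A, _, mem_taiDec_iff unaryEncodingNat⟩

theorem isNPVerifier_binary (A : Type) [Finite A] :
    IsNPVerifier (TAIDec A encodingNatBool) (PlanVerifier encodingNatBool) :=
  ⟨polyTimeDecidable_planVerifier_binary A, _, mem_taiDec_iff encodingNatBool⟩

end TAssembly

open TAssembly Computability in
/-- For every finite alphabet, the decision problem for the templated assembly index is in NP, with
the cost bound in unary or in binary; the sequences of rule applications serve as certificates; and
membership of an object in `Sub(w) ∪ 𝒯(w)` is decidable in polynomial time. -/
theorem mainTheorem2 (A : Type) [Finite A] :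
    (InNP (TAIDec A unaryEncodingNat) ∧ InNP (TAIDec A encodingNatBool)) ∧
    (IsNPVerifier (TAIDec A unaryEncodingNat) (PlanVerifier unaryEncodingNat) ∧
      IsNPVerifier (TAIDec A encodingNatBool) (PlanVerifier encodingNatBool)) ∧
    PolyTimeDecidable (pairEnc A (Option A)) (fun z => z.2 ∈ Objects z.1) := by
  have hu := isNPVerifier_unary A
  have hb := isNPVerifier_binary A
  exact ⟨⟨⟨_, inferInstance, _, hu⟩, ⟨_, inferInstance, _, hb⟩⟩, ⟨hu, hb⟩,
    polyTimeDecidable_mem_objects A⟩
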